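/- Let $\Gamma$ be a discrete group and let $\mathcal F$ be a family of subgroups of $\Gamma$, that is, a set of subgroups closed under conjugation and under intersections of two members (for instance, any set of subgroups closed under conjugation and under passage to subgroups). Let $E\Gamma(\mathcal F)$ be any model of the universal space for $\mathcal F$: a $\Gamma$-CW complex all of whose isotropy groups lie in $\mathcal F$ and such that the fixed set $E\Gamma(\mathcal F)^G$ is contractible for every $G\in\mathcal F$. A spectrum with $\Gamma$-action is a sequence of pointed $\Gamma$-spaces $S_n$ ($n\ge 0$) with $\Gamma$-equivariant pointed structure maps $\Sigma S_n\to S_{n+1}$ ($\Gamma$ acting trivially on the suspension coordinate); an equivariant map of such spectra is a sequence of pointed $\Gamma$-equivariant continuous maps $S_n\to T_n$ commuting with the structure maps. For a subgroup $G\le\Gamma$, the fixed spectrum $S^G$ consists of the fixed sets $S_n^G$. The homotopy fixed spectrum $S^{h\mathcal F\Gamma}=\mathrm{Map}_\Gamma(E\Gamma(\mathcal F),S)$ consists of the spaces of continuous $\Gamma$-equivariant maps $E\Gamma(\mathcal F)\to S_n$. A map of spectra is a weak homotopy equivalence if it induces isomorphisms on the homotopy groups $\pi_k(S)=\operatorname{colim}_n\pi_{k+n}(S_n)$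 for all $k\in\mathbb Z$. A spectrum is an $\Omega$-spectrum if the adjoint structure maps $S_n\to\Omega S_{n+1}$ are weak homotopy equivalences of spaces. Let $F\colon S\to T$ be an equivariant map of spectra with $\Gamma$-action such that $S^G$ and $T^G$ are $\Omega$-spectra for every $G\in\mathcal F$. If $F^G\colon S^G\to T^G$ is a weak homotopy equivalence for every $G\in\mathcal F$, then the induced map $S^{h\mathcal F\Gamma}\to T^{h\mathcal F\Gamma}$ is a weak homotopy equivalence. -/

import Mathlib

open Topology unitInterval

noncomputable section

namespace EquivSpectra

universe u v w

/-! ### Weak homotopy equivalences of spaces -/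

section Spaces

variable {N : Type*} {X Y : Type*} [TopologicalSpace X] [TopologicalSpace Y]

/-- Postcomposition of a generalized loop with a continuous map `f` such that `f x = y`. -/
def genLoopMap (f : C(X, Y)) {x : X} {y : Y} (h : f x = y) (p : GenLoop N X x) :
    GenLoop N Y y :=
  ⟨f.comp p.1, fun z hz => (congrArg f (p.2 z hz)).trans h⟩

/-- The map `π_N(X, x) → π_N(Y, y)` induced by a continuous map `f` such that `f x = y`. -/
def homotopyGroupMap (f : C(X, Y)) {x : X} {y : Y} (h : f x = y) :
    HomotopyGroup N X x → HomotopyGroup N Y y :=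
  Quotient.map (genLoopMap f h) fun _ _ hpq => hpq.map fun H => H.compContinuousMap f

/-- The map induced by a continuous map on sets of path components. -/
def zerothHomotopyMap (f : C(X, Y)) : ZerothHomotopy X → ZerothHomotopy Y :=
  Quotient.map f fun _ _ hab => hab.map f.continuous

/-- A weak homotopy equivalence of spaces: a bijection on path components and on all homotopy
groups at all base points. -/
structure IsWeakHomotopyEquiv (f : C(X, Y)) : Prop where
  bijective_zeroth : Function.Bijective (zerothHomotopyMap f)
  bijective_pi : ∀ (n : ℕ) (x : X),
    Function.Bijective (homotopyGroupMap (N := Fin n) f (rfl : f x = f x))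

end Spaces

/-! ### Spectra -/

/-- A (sequential, topological) spectrum: pointed spaces `S₀, S₁, …` with structure maps
`Σ Sₙ → Sₙ₊₁` out of the reduced suspension, i.e. continuous maps `Sₙ × [0, 1] → Sₙ₊₁` that
collapse `Sₙ × {0, 1} ∪ {pt} × [0, 1]` to the base point. -/
structure Spectrum where
  space : ℕ → Type u
  [top : ∀ n, TopologicalSpace (space n)]
  pt : ∀ n, space n
  str : ∀ n, C(space n × I, space (n + 1))
  str_zero : ∀ n x, str n (x, 0) = pt (n + 1)
  str_one : ∀ n x, str n (x, 1) = pt (n + 1)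
  str_pt : ∀ n t, str n (pt n, t) = pt (n + 1)

attribute [instance] Spectrum.top

namespace Spectrum

/-- The adjoint structure map `Sₙ → Ω Sₙ₊₁`. -/
def adjoint (S : Spectrum.{u}) (n : ℕ) :
    C(S.space n, LoopSpace (S.space (n + 1)) (S.pt (n + 1))) where
  toFun x :=
    { toFun := fun t => S.str n (x, t)
      continuous_toFun := by fun_prop
      source' := S.str_zero n x
      target' := S.str_one n x }
  continuous_toFun := by
    refine continuous_induced_rng.2 ?_
    exact (S.str n).curry.continuous

/-- An `Ω`-spectrum: all adjoint structure maps are weak homotopy equivalences. -/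
def IsOmega (S : Spectrum.{u}) : Prop :=
  ∀ n, IsWeakHomotopyEquiv (S.adjoint n)

/-- A map of spectra: pointed maps `Sₙ → Tₙ` that commute with the structure maps. -/
structure Hom (S : Spectrum.{u}) (T : Spectrum.{v}) where
  map : ∀ n, C(S.space n, T.space n)
  map_pt : ∀ n, map n (S.pt n) = T.pt n
  map_str : ∀ n x t, map (n + 1) (S.str n (x, t)) = T.str n (map n x, t)

/-- The suspension `Ω^m Sₙ → Ω^(m+1) Sₙ₊₁` of a loop: suspend, then apply the structure map. -/
def suspLoop (S : Spectrum.{u}) (m n : ℕ) (p : GenLoop (Fin m) (S.space n) (S.pt n)) :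
    GenLoop (Fin (m + 1)) (S.space (n + 1)) (S.pt (n + 1)) :=
  ⟨(S.str n).comp
      ⟨fun y => (p.1 fun i => y i.castSucc, y (Fin.last m)), by fun_prop⟩, by
    rintro y ⟨i, hi⟩
    change S.str n (p.1 fun i => y i.castSucc, y (Fin.last m)) = _
    induction i using Fin.lastCases with
    | last =>
      rcases hi with hi | hi
      · rw [hi, S.str_zero]
      · rw [hi, S.str_one]
    | cast i => rw [p.2 _ ⟨i, hi⟩, S.str_pt]⟩

/-- The suspension homomorphism `π_m(Sₙ) → π_{m+1}(Sₙ₊₁)`. -/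
def susp (S : Spectrum.{u}) (m n : ℕ) :
    HomotopyGroup.Pi m (S.space n) (S.pt n) →
      HomotopyGroup.Pi (m + 1) (S.space (n + 1)) (S.pt (n + 1)) :=
  Quotient.map (S.suspLoop m n) fun p q hpq => by
    obtain ⟨H⟩ := hpq
    refine ⟨⟨⟨(S.str n).comp
        ⟨fun z => (H (z.1, fun i => z.2 i.castSucc), z.2 (Fin.last m)), by fun_prop⟩,
      ?_, ?_⟩, ?_⟩⟩
    · intro y
      change S.str n (H (0, _), _) = S.str n (p.1 _, _)
      rw [H.apply_zero]
    · intro y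
      change S.str n (H (1, _), _) = S.str n (q.1 _, _)
      rw [H.apply_one]
    · rintro t y ⟨i, hi⟩
      change S.str n (H (t, fun i => y i.castSucc), y (Fin.last m)) =
        S.str n (p.1 fun i => y i.castSucc, y (Fin.last m))
      induction i using Fin.lastCases with
      | last =>
        rcases hi with hi | hi
        · rw [hi, S.str_zero, S.str_zero]
        · rw [hi, S.str_one, S.str_one]
      | cast i => rw [H.eq_fst t (show _ ∈ Cube.boundary (Fin m) from ⟨i, hi⟩)]

/-- The terms `π_{p+n}(S_{q+n})`, `n = 0, 1, …`, of the sequence defining the homotopy group of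
degree `k = p - q`, where `p = max k 0` and `q = max (-k) 0`. -/
abbrev Term (S : Spectrum.{u}) (k : ℤ) (n : ℕ) : Type u :=
  HomotopyGroup.Pi (k.toNat + n) (S.space ((-k).toNat + n)) (S.pt ((-k).toNat + n))

/-- The homotopy group `π_k(S) = colim_n π_{k+n}(S_n)` of a spectrum, `k ∈ ℤ` (its underlying set):
the disjoint union of the terms, modulo the relation generated by `a ∼ susp a`. -/
def Pi (S : Spectrum.{u}) (k : ℤ) : Type u :=
  Quot fun a b : Σ n, S.Term k n => b = ⟨a.1 + 1, S.susp _ _ a.2⟩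

/-- The map `π_m(Sₙ) → π_m(Tₙ)` induced by a map of spectra. -/
def Hom.termMap {S : Spectrum.{u}} {T : Spectrum.{v}} (F : S.Hom T) (m n : ℕ) :
    HomotopyGroup.Pi m (S.space n) (S.pt n) → HomotopyGroup.Pi m (T.space n) (T.pt n) :=
  homotopyGroupMap (F.map n) (F.map_pt n)

theorem Hom.termMap_susp {S : Spectrum.{u}} {T : Spectrum.{v}} (F : S.Hom T) (m n : ℕ)
    (a : HomotopyGroup.Pi m (S.space n) (S.pt n)) :
    F.termMap (m + 1) (n + 1) (S.susp m n a) = T.susp m n (F.termMap m n a) := by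
  induction a using Quotient.inductionOn with
  | h p =>
    refine congrArg (Quotient.mk _) ?_
    ext y
    exact F.map_str n _ _

/-- The map `π_k(S) → π_k(T)` induced by a map of spectra. -/
def Hom.piMap {S : Spectrum.{u}} {T : Spectrum.{v}} (F : S.Hom T) (k : ℤ) : S.Pi k → T.Pi k :=
  Quot.map (fun a => ⟨a.1, F.termMap _ _ a.2⟩) (by
    rintro a b rfl
    exact congrArg (Sigma.mk (a.1 + 1)) (F.termMap_susp _ _ a.2))

/-- A weak homotopy equivalence of spectra: it induces isomorphisms on all homotopy groups `π_k`,
`k ∈ ℤ`. -/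
def Hom.IsWeakEquiv {S : Spectrum.{u}} {T : Spectrum.{v}} (F : S.Hom T) : Prop :=
  ∀ k : ℤ, Function.Bijective (F.piMap k)

end Spectrum

/-! ### Spectra with an action of a discrete group -/

/-- A spectrum with an action of the discrete group `Γ`: `Γ` acts on each space by pointed
continuous maps, and the structure maps are equivariant (`Γ` acts trivially on the suspension
coordinate). -/
structure GSpectrum (Γ : Type w) [Group Γ] extends Spectrum.{u} where
  [action : ∀ n, MulAction Γ (space n)]
  continuous_smul : ∀ n (γ : Γ), Continuous fun x : space n => γ • x
  smul_pt : ∀ n (γ : Γ), γ • pt n = pt n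
  str_smul : ∀ n (γ : Γ) x t, str n (γ • x, t) = γ • str n (x, t)

attribute [instance] GSpectrum.action

namespace GSpectrum

variable {Γ : Type w} [Group Γ]

/-- An equivariant map of spectra with `Γ`-action. -/
structure Hom (S : GSpectrum.{u} Γ) (T : GSpectrum.{v} Γ) extends
    Spectrum.Hom S.toSpectrum T.toSpectrum where
  map_smul : ∀ n (γ : Γ) x, map n (γ • x) = γ • map n x

/-- The fixed spectrum `S^G`, with spaces the fixed sets `(Sₙ)^G`. -/
def fixed (S : GSpectrum.{u} Γ) (G : Subgroup Γ) : Spectrum.{u} where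
  space n := MulAction.fixedPoints G (S.space n)
  pt n := ⟨S.pt n, fun g => S.smul_pt n g⟩
  str n :=
    { toFun := fun z => ⟨S.str n (z.1.1, z.2), fun g =>
        (S.str_smul n g z.1.1 z.2).symm.trans
          (congrArg (fun x => S.str n (x, z.2)) (z.1.2 g))⟩
      continuous_toFun := by fun_prop }
  str_zero n x := Subtype.ext (S.str_zero n x.1)
  str_one n x := Subtype.ext (S.str_one n x.1)
  str_pt n t := Subtype.ext (S.str_pt n t)

/-- The map of fixed spectra `F^G : S^G → T^G` induced by an equivariant map. -/
def Hom.fixed {S : GSpectrum.{u} Γ} {T : GSpectrum.{v} Γ} (F : S.Hom T) (G : Subgroup Γ) :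
    (S.fixed G).Hom (T.fixed G) where
  map n :=
    { toFun := fun x => ⟨F.map n x.1, fun g =>
        (F.map_smul n g x.1).symm.trans (congrArg (F.map n) (x.2 g))⟩
      continuous_toFun := by fun_prop }
  map_pt n := Subtype.ext (F.map_pt n)
  map_str n x t := Subtype.ext (F.map_str n x.1 t)

/-- The spectrum `Map_Γ(E, S)`, with spaces the spaces of continuous `Γ`-equivariant maps
`E → Sₙ` (compact-open topology), base points the constant maps, and structure maps applied
pointwise. -/
def mapSpectrum (S : GSpectrum.{u} Γ) (E : Type v) [TopologicalSpace E] [MulAction Γ E] :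
    Spectrum.{max u v} where
  space n := {f : C(E, S.space n) // ∀ (γ : Γ) x, f (γ • x) = γ • f x}
  pt n := ⟨ContinuousMap.const E (S.pt n), fun γ _ => (S.smul_pt n γ).symm⟩
  str n :=
    { toFun := fun z => ⟨(S.str n).comp (z.1.1.prodMk (ContinuousMap.const E z.2)),
        fun γ x => by
          simp only [ContinuousMap.comp_apply, ContinuousMap.prod_eval,
            ContinuousMap.const_apply]
          rw [z.1.2, S.str_smul]⟩
      continuous_toFun := by
        refine Continuous.subtype_mk ?_ _
        exact ((S.str n).comp ContinuousMap.prodSwap).continuous_postcomp.comp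
          (ContinuousMap.continuous_prodMk_const.comp
            (continuous_snd.prodMk (continuous_subtype_val.comp continuous_fst))) }
  str_zero n _ := Subtype.ext (ContinuousMap.ext fun _ => S.str_zero n _)
  str_one n _ := Subtype.ext (ContinuousMap.ext fun _ => S.str_one n _)
  str_pt n t := Subtype.ext (ContinuousMap.ext fun _ => S.str_pt n t)

/-- The map `Map_Γ(E, S) → Map_Γ(E, T)` given by composition with an equivariant map `S → T`. -/
def Hom.mapSpectrum {S : GSpectrum.{u} Γ} {T : GSpectrum.{v} Γ} (F : S.Hom T)
    (E : Type*) [TopologicalSpace E] [MulAction Γ E] :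
    (S.mapSpectrum E).Hom (T.mapSpectrum E) where
  map n :=
    { toFun := fun f => ⟨(F.map n).comp f.1, fun γ x =>
        (congrArg (F.map n) (f.2 γ x)).trans (F.map_smul n γ _)⟩
      continuous_toFun :=
        (((F.map n).continuous_postcomp).comp continuous_subtype_val).subtype_mk _ }
  map_pt n := Subtype.ext (ContinuousMap.ext fun _ => F.map_pt n)
  map_str n _ _ := Subtype.ext (ContinuousMap.ext fun _ => F.map_str n _ _)

end GSpectrum

/-! ### Γ-CW complexes and classifying spaces for families -/

open Metric Set

/-- The structure of a `Γ`-CW complex on a Hausdorff `Γ`-space `E`, for a discrete group `Γ`.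
An equivariant `n`-cell `i` has the form `Γ/H × Dⁿ`, with `H = stab n i`; its characteristic map
`Γ/H × Dⁿ → E` is `(γH, x) ↦ γ • map n i x`. As in Mathlib's `CWComplex`, the disc `Dⁿ` is the
closed unit ball of `Fin n → ℝ` (for the maximum norm). -/
structure GammaCWComplex (Γ : Type w) [Group Γ] (E : Type v) [TopologicalSpace E]
    [MulAction Γ E] where
  t2 : T2Space E
  continuous_smul : ∀ γ : Γ, Continuous fun x : E => γ • x
  cell : ℕ → Type v
  stab : ∀ n, cell n → Subgroup Γ
  map : ∀ n, cell n → C(closedBall (0 : Fin n → ℝ) 1, E)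
  /-- `(γH, x) ↦ γ • map n i x` is well defined. -/
  smul_map : ∀ n i, ∀ γ ∈ stab n i, ∀ x, γ • map n i x = map n i x
  /-- The characteristic map is injective on `Γ/H × int Dⁿ`. -/
  injective : ∀ n i (γ : Γ) x y, x.1 ∈ ball 0 1 → y.1 ∈ ball 0 1 →
    γ • map n i x = map n i y → γ ∈ stab n i ∧ x = y
  /-- Different open equivariant cells are disjoint. -/
  disjoint : ∀ (c d : Σ n, cell n) (γ : Γ) x y, x.1 ∈ ball 0 1 → y.1 ∈ ball 0 1 →
    γ • map c.1 c.2 x = map d.1 d.2 y → c = d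
  /-- The cells cover `E`. -/
  cover : ∀ z : E, ∃ n i x, ∃ γ : Γ, γ • map n i x = z
  /-- The boundary of a cell lies in a finite union of closed cells of lower dimension. -/
  boundary : ∀ n (i : cell n), ∃ J : ∀ m, Finset (Γ × cell m), ∀ x, x.1 ∈ sphere 0 1 →
    ∃ m < n, ∃ j ∈ J m, ∃ y, map n i x = j.1 • map m j.2 y
  /-- `E` carries the weak topology determined by the characteristic maps. -/
  isClosed : ∀ A : Set E,
    (∀ n i (γ : Γ), IsClosed ((fun x => γ • map n i x) ⁻¹' A)) → IsClosed A

/-- A family of subgroups of `Γ`: a set of subgroups closed under conjugation and under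
intersections of two members. In particular, every set of subgroups that is closed under conjugation
and under passage to subgroups is a family. -/
structure IsFamily {Γ : Type w} [Group Γ] (𝓕 : Set (Subgroup Γ)) : Prop where
  conj : ∀ H ∈ 𝓕, ∀ γ : Γ, H.map (MulAut.conj γ).toMonoidHom ∈ 𝓕
  inter : ∀ H ∈ 𝓕, ∀ K ∈ 𝓕, H ⊓ K ∈ 𝓕

/-- `E` is (a model for) the universal space `EΓ(𝓕)`: a `Γ`-CW complex, all of whose isotropy
groups belong to `𝓕`, such that `E^H` is contractible for every `H ∈ 𝓕`. -/
structure IsUniversalSpace {Γ : Type w} [Group Γ] (𝓕 : Set (Subgroup Γ)) (E : Type v)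
    [TopologicalSpace E] [MulAction Γ E] : Prop where
  cw : Nonempty (GammaCWComplex Γ E)
  isotropy : ∀ x : E, MulAction.stabilizer Γ x ∈ 𝓕
  contractible : ∀ H ∈ 𝓕, ContractibleSpace (MulAction.fixedPoints H E)

/-- The homotopy fixed spectrum `S^{h𝓕Γ} = Map_Γ(EΓ(𝓕), S)`, for a model `E` of `EΓ(𝓕)`. -/
abbrev GSpectrum.homotopyFixed {Γ : Type w} [Group Γ] (S : GSpectrum.{u} Γ)
    {𝓕 : Set (Subgroup Γ)} (E : Type v) [TopologicalSpace E] [MulAction Γ E]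
    (_hE : IsUniversalSpace 𝓕 E) : Spectrum.{max u v} :=
  S.mapSpectrum E

/-- The map `S^{h𝓕Γ} → T^{h𝓕Γ}` induced by an equivariant map `S → T`. -/
abbrev GSpectrum.Hom.homotopyFixed {Γ : Type w} [Group Γ] {S : GSpectrum.{u} Γ}
    {T : GSpectrum.{v} Γ} (F : S.Hom T) {𝓕 : Set (Subgroup Γ)} (E : Type*)
    [TopologicalSpace E] [MulAction Γ E] (hE : IsUniversalSpace 𝓕 E) :
    (S.homotopyFixed E hE).Hom (T.homotopyFixed E hE) :=
  F.mapSpectrum E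

end EquivSpectra

end

open Topology unitInterval

noncomputable section

namespace EquivSpectra

universe u v w

/-! ### Sequential colimits -/

section Colimit

variable {A : Type*} {f : A → A}

/-! The argument is equivariant obstruction theory applied to homotopy fibres, level by level.

Fix a level `n` and an isotropy group `G` of `E`, so that `G` lies in the family. For Ω-spectra
every map in the colimit defining `π_k` is a bijection, so a weak equivalence `S^G → T^G` is already
bijective on `π_m` of the `n`-th spaces at the base points, for all `m` and `n`
(`termMap_bijective`). By the exactness argument of the long exact sequence, all homotopy groups of
the homotopy fibre of `S_n^G → T_n^G` then vanish (`joinedIn_relLoops`). An `m`-loop in that fibre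
is a point of `relLoops`. A `j`-loop of `G`-fixed such points is a `(j + m)`-loop in the fibre of
the fixed sets, hence null homotopic (`isLoopNull_relLoops`).

Consequently there is no obstruction to contracting an equivariant map from `E` to `relLoops`: a
contraction is an equivariant section of a family of path spaces, and such a section extends over
one orbit of cells at a time (`exists_section`, `exists_nullHomotopy`). By exchange of variables,
such maps are exactly loops in the homotopy fibre of `Map_Γ(E, S_n) → Map_Γ(E, T_n)`. So the
homotopy groups of this fibre vanish, and the map is bijective on `π_m` for `m > 0`
(`bijective_of_joinedIn_relLoops`). Degree 0 may be ignored because every class in the colimit is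
represented in positive degree (`isWeakEquiv_of_bijective`). -/

theorem quot_mk_iterate (r : ℕ) (x : A) :
    Quot.mk (fun a b => b = f a) (f^[r] x) = Quot.mk _ x := by
  induction r with
  | zero => rfl
  | succ r ih => rw [Function.iterate_succ_apply', ← ih]; exact (Quot.sound (r := fun a b => b = f a) rfl).symm

/-- A zigzag of applications of a single self-map can be straightened: two meeting points have a
common iterate, since iterates of `f` commute. -/
theorem quot_mk_eq_iff {x y : A} :
    Quot.mk (fun a b => b = f a) x = Quot.mk _ y ↔ ∃ r s, f^[r] x = f^[s] y := by
  constructor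
  · intro h
    have h' := Quot.eqvGen_exact h
    clear h
    induction h' with
    | rel a b h => exact ⟨1, 0, h.symm⟩
    | refl a => exact ⟨0, 0, rfl⟩
    | symm a b _ ih => obtain ⟨r, s, h⟩ := ih; exact ⟨s, r, h.symm⟩
    | trans a b c _ _ h₁ h₂ =>
      obtain ⟨r, s, h₁⟩ := h₁
      obtain ⟨r', s', h₂⟩ := h₂
      refine ⟨r' + r, s + s', ?_⟩
      rw [Function.iterate_add_apply, h₁, ← Function.iterate_add_apply, add_comm,
        Function.iterate_add_apply, h₂, Function.iterate_add_apply]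
  · rintro ⟨r, s, h⟩
    rw [← quot_mk_iterate r x, h, quot_mk_iterate]

end Colimit

/-! ### Homotopy groups of spectra as sequential colimits -/

namespace Spectrum

variable {S : Spectrum.{u}} {T : Spectrum.{v}}

/-- The suspension on the disjoint union of the terms of the sequence defining `π_k`. -/
def shift (S : Spectrum.{u}) (k : ℤ) (a : Σ n, S.Term k n) : Σ n, S.Term k n :=
  ⟨a.1 + 1, S.susp _ _ a.2⟩

theorem shift_iterate_fst (k : ℤ) (r : ℕ) (a : Σ n, S.Term k n) :
    ((S.shift k)^[r] a).1 = a.1 + r := by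
  induction r with
  | zero => rfl
  | succ r ih => rw [Function.iterate_succ_apply']; change _ + 1 = _; rw [ih, add_assoc]

theorem shift_injective (h : ∀ m n, Function.Injective (S.susp m n)) (k : ℤ) :
    Function.Injective (S.shift k) := by
  rintro ⟨m, a⟩ ⟨n, b⟩ hab
  obtain rfl : m = n := Nat.succ_injective (congrArg Sigma.fst hab)
  exact congrArg _ (h _ _ (eq_of_heq (Sigma.mk.inj hab).2))

/-- The map from a term of the defining sequence to `π_k(S)`. -/
def toPi (S : Spectrum.{u}) (k : ℤ) (n : ℕ) (a : S.Term k n) : S.Pi k := Quot.mk _ ⟨n, a⟩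

theorem pi_mk_eq_iff {k : ℤ} {a b : Σ n, S.Term k n} :
    (Quot.mk _ a : S.Pi k) = Quot.mk _ b ↔ ∃ r s, (S.shift k)^[r] a = (S.shift k)^[s] b :=
  quot_mk_eq_iff (f := S.shift k)

theorem toPi_injective (h : ∀ m n, Function.Injective (S.susp m n)) (k : ℤ) (n : ℕ) :
    Function.Injective (S.toPi k n) := by
  intro a b hab
  obtain ⟨r, s, hrs⟩ := pi_mk_eq_iff.1 hab
  have := congrArg Sigma.fst hrs
  rw [shift_iterate_fst, shift_iterate_fst] at this
  -- Each shift raises the index by one, so elements of the same term can only meet after equally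
  -- many shifts.
  obtain rfl : r = s := Nat.add_left_cancel this
  exact eq_of_heq (Sigma.mk.inj ((shift_injective h k).iterate r hrs)).2

theorem toPi_surjective (h : ∀ m n, Function.Surjective (S.susp m n)) (k : ℤ) (n : ℕ) :
    Function.Surjective (S.toPi k n) := by
  have key : ∀ j (b : S.Term k j), ∃ b' : S.Term k 0, S.toPi k j b = S.toPi k 0 b' := by
    intro j
    induction j with
    | zero => exact fun b => ⟨b, rfl⟩
    | succ j ih =>
      intro b
      obtain ⟨b', hb'⟩ := h _ _ b
      obtain ⟨b'', hb''⟩ := ih b'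
      exact ⟨b'', (Quot.sound (by rw [← hb'])).symm.trans hb''⟩
  have key' : ∀ j (b : S.Term k 0), ∃ b' : S.Term k j, S.toPi k 0 b = S.toPi k j b' := by
    intro j b
    induction j with
    | zero => exact ⟨b, rfl⟩
    | succ j ih =>
      obtain ⟨b', hb'⟩ := ih
      exact ⟨S.susp _ _ b', hb'.trans (Quot.sound rfl)⟩
  intro b
  induction b using Quot.inductionOn with
  | h b =>
    obtain ⟨b', hb'⟩ := key b.1 b.2
    obtain ⟨b'', hb''⟩ := key' n b'
    exact ⟨b'', (hb'.trans hb'').symm⟩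

/-! ### Homotopy groups of Ω-spectra -/

/-- Up to currying the last cube coordinate, suspension is the map induced on `π_m` by the adjoint
structure map. A homotopy of suspended loops is thus read as a homotopy of loops in `Ω S_{n+1}`. -/
theorem IsOmega.susp_injective (hS : S.IsOmega) (m n : ℕ) :
    Function.Injective (S.susp m n) := by
  intro a b
  induction a using Quotient.inductionOn with
  | h p =>
  induction b using Quotient.inductionOn with
  | h q =>
  intro hab
  obtain ⟨H⟩ := Quotient.exact hab
  refine ((hS n).bijective_pi m (S.pt n)).1 (Quotient.sound ⟨⟨⟨⟨fun z =>
    { toFun := fun t => H (z.1, Fin.snoc z.2 t)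
      continuous_toFun := by fun_prop
      source' := ?_
      target' := ?_ }, ?_⟩, ?_, ?_⟩, ?_⟩⟩)
  · rw [H.eq_fst _ (show _ ∈ Cube.boundary _ from ⟨Fin.last m, by simp⟩)]
    change S.str n (_, (Fin.snoc z.2 0 : Fin (m + 1) → I) (Fin.last m)) = _
    rw [Fin.snoc_last, S.str_zero]
  · rw [H.eq_fst _ (show _ ∈ Cube.boundary _ from ⟨Fin.last m, by simp⟩)]
    change S.str n (_, (Fin.snoc z.2 1 : Fin (m + 1) → I) (Fin.last m)) = _
    rw [Fin.snoc_last, S.str_one]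
  · refine continuous_induced_rng.2 (ContinuousMap.continuous_of_continuous_uncurry _ ?_)
    change Continuous fun z : (I × (Fin m → I)) × I => H (z.1.1, Fin.snoc z.1.2 z.2)
    fun_prop
  · intro u
    ext t
    change H (0, _) = S.str n (p.1 u, t)
    rw [H.apply_zero]
    change S.str n (p.1 fun i => (Fin.snoc u t : Fin (m + 1) → I) i.castSucc,
      (Fin.snoc u t : Fin (m + 1) → I) (Fin.last m)) = _
    simp
  · intro u
    ext t
    change H (1, _) = S.str n (q.1 u, t)
    rw [H.apply_one]
    change S.str n (q.1 fun i => (Fin.snoc u t : Fin (m + 1) → I) i.castSucc,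
      (Fin.snoc u t : Fin (m + 1) → I) (Fin.last m)) = _
    simp
  · rintro s u ⟨i, hi⟩
    ext t
    change H (s, _) = S.str n (p.1 u, t)
    rw [H.eq_fst _ (show _ ∈ Cube.boundary _ from ⟨i.castSucc, by simpa using hi⟩)]
    change S.str n (p.1 fun i => (Fin.snoc u t : Fin (m + 1) → I) i.castSucc,
      (Fin.snoc u t : Fin (m + 1) → I) (Fin.last m)) = _
    simp

theorem IsOmega.susp_surjective (hS : S.IsOmega) (m n : ℕ) :
    Function.Surjective (S.susp m n) := by
  intro b
  induction b using Quotient.inductionOn with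
  | h r =>
  have hpt : ∀ t, S.adjoint n (S.pt n) t = S.pt (n + 1) := S.str_pt n
  -- The given loop with its last coordinate turned into a path parameter; the Ω-condition supplies
  -- a preimage of its class.
  let r' : GenLoop (Fin m) (LoopSpace (S.space (n + 1)) (S.pt (n + 1)))
      (S.adjoint n (S.pt n)) :=
    ⟨⟨fun u =>
      { toFun := fun t => r.1 (Fin.snoc u t)
        continuous_toFun := by fun_prop
        source' := r.2 _ ⟨Fin.last m, by simp⟩
        target' := r.2 _ ⟨Fin.last m, by simp⟩ }, by
      refine continuous_induced_rng.2 (ContinuousMap.continuous_of_continuous_uncurry _ ?_)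
      change Continuous fun z : (Fin m → I) × I => r.1 (Fin.snoc z.1 z.2)
      fun_prop⟩, by
      rintro u ⟨i, hi⟩
      ext t
      rw [hpt]
      exact r.2 _ ⟨i.castSucc, by simpa using hi⟩⟩
  obtain ⟨a, ha⟩ := ((hS n).bijective_pi m (S.pt n)).2 (Quotient.mk _ r')
  induction a using Quotient.inductionOn with
  | h p =>
  obtain ⟨H⟩ := Quotient.exact ha
  refine ⟨Quotient.mk _ p, Quotient.sound ⟨⟨⟨⟨fun z => H (z.1, fun i => z.2 i.castSucc)
    (z.2 (Fin.last m)), by fun_prop⟩, ?_, ?_⟩, ?_⟩⟩⟩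
  · intro y
    change H (0, _) _ = S.str n (p.1 _, _)
    rw [H.apply_zero]
    rfl
  · intro y
    change H (1, _) _ = r.1 y
    rw [H.apply_one]
    change r.1 (Fin.snoc (fun i => y i.castSucc) (y (Fin.last m))) = r.1 y
    congr 1
    exact Fin.snoc_init_self y
  · rintro s y ⟨i, hi⟩
    change H (s, fun i => y i.castSucc) (y (Fin.last m)) =
      S.str n (p.1 fun i => y i.castSucc, y (Fin.last m))
    induction i using Fin.lastCases with
    | last =>
      rcases hi with hi | hi
      · rw [hi, S.str_zero]
        exact (H (s, fun i => y i.castSucc) : Path _ _).source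
      · rw [hi, S.str_one]
        exact (H (s, fun i => y i.castSucc) : Path _ _).target
    | cast i =>
      rw [H.eq_fst _ (show _ ∈ Cube.boundary _ from ⟨i, hi⟩)]
      rfl

/-- A weak equivalence of Ω-spectra induces bijections on the homotopy groups, at the base points,
of the spaces of the spectra. -/
theorem Hom.IsWeakEquiv.termMap_bijective {F : S.Hom T} (hF : F.IsWeakEquiv) (hS : S.IsOmega)
    (hT : T.IsOmega) (m n : ℕ) : Function.Bijective (F.termMap m n) := by
  -- Every pair `(m, n)` occurs in exactly the sequence of degree `m - n`, at position `min m n`.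
  obtain ⟨k, j, rfl, rfl⟩ : ∃ (k : ℤ) (j : ℕ), m = k.toNat + j ∧ n = (-k).toNat + j :=
    ⟨m - n, min m n, by omega, by omega⟩
  have h : T.toPi k j ∘ F.termMap _ _ = F.piMap k ∘ S.toPi k j := rfl
  have hT' : Function.Bijective (T.toPi k j) :=
    ⟨toPi_injective hT.susp_injective k j, toPi_surjective hT.susp_surjective k j⟩
  rw [← Function.Bijective.of_comp_iff' hT', h]
  exact (hF k).comp
    ⟨toPi_injective hS.susp_injective k j, toPi_surjective hS.susp_surjective k j⟩

theorem shift_termMap (F : S.Hom T) (k : ℤ) (r : ℕ) (a : Σ n, S.Term k n) :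
    (⟨_, F.termMap _ _ ((S.shift k)^[r] a).2⟩ : Σ n, T.Term k n) =
      (T.shift k)^[r] ⟨a.1, F.termMap _ _ a.2⟩ := by
  induction r with
  | zero => rfl
  | succ r ih =>
    rw [Function.iterate_succ_apply', Function.iterate_succ_apply', ← ih]
    exact congrArg (Sigma.mk _) (F.termMap_susp _ _ _)

/-- A map of spectra that is bijective on the homotopy groups of positive degree of all the spaces
is a weak equivalence. -/
theorem Hom.isWeakEquiv_of_bijective {F : S.Hom T}
    (h : ∀ m n, Function.Bijective (F.termMap (m + 1) n)) : F.IsWeakEquiv := by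
  refine fun k => ⟨fun a b => ?_, fun b => ?_⟩
  · induction a using Quot.inductionOn with
    | h a =>
    induction b using Quot.inductionOn with
    | h b =>
    intro hab
    obtain ⟨r, s, hrs⟩ := pi_mk_eq_iff.1 hab
    -- One extra suspension moves both representatives to positive degree, where the hypothesis
    -- applies.
    refine pi_mk_eq_iff.2 ⟨r + 1, s + 1, ?_⟩
    have hrs' := congrArg (T.shift k) hrs
    rw [← Function.iterate_succ_apply' (T.shift k), ← Function.iterate_succ_apply' (T.shift k),
      ← shift_termMap, ← shift_termMap, Function.iterate_succ_apply' (S.shift k),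
      Function.iterate_succ_apply' (S.shift k)] at hrs'
    rw [Function.iterate_succ_apply', Function.iterate_succ_apply']
    generalize (S.shift k)^[r] a = a' at hrs'
    generalize (S.shift k)^[s] b = b' at hrs'
    obtain ⟨i, a'⟩ := a'
    obtain ⟨j, b'⟩ := b'
    obtain rfl : i = j := Nat.succ_injective (congrArg Sigma.fst hrs')
    exact congrArg (Sigma.mk _) ((h _ _).1 (eq_of_heq (Sigma.mk.inj hrs').2))
  · induction b using Quot.inductionOn with
    | h b =>
    -- The representative is suspended once, because it may itself have degree 0.
    obtain ⟨a, ha⟩ := (h _ _).2 (T.susp _ _ b.2)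
    refine ⟨Quot.mk _ ⟨b.1 + 1, a⟩, ?_⟩
    change Quot.mk _ _ = _
    exact pi_mk_eq_iff.2 ⟨0, 1, congrArg (Sigma.mk (b.1 + 1)) ha⟩

end Spectrum

/-! ### Generalized loops as loops in spaces of generalized loops -/

section Loops

variable {X Y Z : Type*} [TopologicalSpace X] [TopologicalSpace Y] [TopologicalSpace Z]
  {N : Type*} {m : ℕ} {x : X} {y : Y}

theorem continuous_genLoop_mk {k : Z → GenLoop N X x}
    (hk : Continuous fun z : Z × (N → I) => (k z.1).1 z.2) : Continuous k :=
  continuous_induced_rng.2 (ContinuousMap.continuous_of_continuous_uncurry _ hk)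

theorem snoc_mem_boundary {u : Fin m → I} (hu : u ∈ Cube.boundary (Fin m)) (t : I) :
    (Fin.snoc u t : Fin (m + 1) → I) ∈ Cube.boundary (Fin (m + 1)) := by
  obtain ⟨i, hi⟩ := hu
  exact ⟨i.castSucc, by simpa using hi⟩

theorem genLoop_homotopic_iff_joined {p q : GenLoop N X x} :
    GenLoop.Homotopic p q ↔ Joined p q := by
  constructor
  · rintro ⟨H⟩
    refine ⟨⟨⟨fun t => ⟨⟨fun u => H (t, u), by fun_prop⟩, fun u hu => ?_⟩, ?_⟩, ?_, ?_⟩⟩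
    · exact (H.eq_fst t hu).trans (p.2 u hu)
    · refine continuous_genLoop_mk ?_
      exact H.continuous
    · exact GenLoop.ext _ _ fun u => H.apply_zero u
    · exact GenLoop.ext _ _ fun u => H.apply_one u
  · rintro ⟨γ⟩
    refine ⟨⟨⟨⟨fun z => γ z.1 z.2, by fun_prop⟩, fun u => ?_, fun u => ?_⟩, fun t u hu => ?_⟩⟩
    · change γ 0 u = p u
      rw [γ.source]
    · change γ 1 u = q u
      rw [γ.target]
    · exact ((γ t).2 u hu).trans (p.2 u hu).symm

/-- An `(m + 1)`-loop as a loop in the space of `m`-loops. -/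
def genLoopToPath (p : GenLoop (Fin (m + 1)) X x) :
    Path (GenLoop.const : GenLoop (Fin m) X x) GenLoop.const where
  toFun t := ⟨⟨fun u => p.1 (Fin.snoc u t), by fun_prop⟩,
    fun _ hu => p.2 _ (snoc_mem_boundary hu t)⟩
  continuous_toFun := by
    refine continuous_genLoop_mk ?_
    change Continuous fun z : I × (Fin m → I) => p.1 (Fin.snoc z.2 z.1)
    fun_prop
  source' := GenLoop.ext _ _ fun _ => p.2 _ ⟨Fin.last m, by simp⟩
  target' := GenLoop.ext _ _ fun _ => p.2 _ ⟨Fin.last m, by simp⟩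

/-- A loop in the space of `m`-loops as an `(m + 1)`-loop. -/
def genLoopOfPath (p : Path (GenLoop.const : GenLoop (Fin m) X x) GenLoop.const) :
    GenLoop (Fin (m + 1)) X x :=
  ⟨⟨fun u => p (u (Fin.last m)) fun i => u i.castSucc, by fun_prop⟩, by
    rintro u ⟨i, hi⟩
    change p (u (Fin.last m)) (fun i => u i.castSucc) = x
    induction i using Fin.lastCases with
    | last => rcases hi with hi | hi <;> rw [hi] <;> simp
    | cast i => exact (p _).2 _ ⟨i, hi⟩⟩

theorem genLoopOfPath_toPath (p : GenLoop (Fin (m + 1)) X x) :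
    genLoopOfPath (genLoopToPath p) = p :=
  GenLoop.ext _ _ fun u => congrArg p.1 (Fin.snoc_init_self u)

/-- Makes the groupoid calculus of paths available for homotopy groups of positive degree. -/
theorem path_homotopic_iff {p q : Path (GenLoop.const : GenLoop (Fin m) X x) GenLoop.const} :
    p.Homotopic q ↔ GenLoop.Homotopic (genLoopOfPath p) (genLoopOfPath q) := by
  constructor
  · rintro ⟨H⟩
    refine ⟨⟨⟨⟨fun z => H (z.1, z.2 (Fin.last m)) fun i => z.2 i.castSucc, by fun_prop⟩,
      fun u => ?_, fun u => ?_⟩, ?_⟩⟩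
    · change H (0, u (Fin.last m)) _ = p _ _
      rw [H.apply_zero]
      rfl
    · change H (1, u (Fin.last m)) _ = q _ _
      rw [H.apply_one]
      rfl
    · rintro t u ⟨i, hi⟩
      refine Eq.trans ?_ ((genLoopOfPath p).2 u ⟨i, hi⟩).symm
      change H (t, u (Fin.last m)) (fun i => u i.castSucc) = x
      induction i using Fin.lastCases with
      | last =>
        rcases hi with hi | hi
        · rw [hi, H.source]; rfl
        · rw [hi, H.target]; rfl
      | cast i => exact (H _).2 _ ⟨i, hi⟩
  · rintro ⟨H⟩
    have key (r : Path (GenLoop.const : GenLoop (Fin m) X x) GenLoop.const) (t : I)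
        (u : Fin m → I) : (genLoopOfPath r).1 (Fin.snoc u t) = r t u := by
      change r ((Fin.snoc u t : Fin (m + 1) → I) (Fin.last m))
        (fun i => (Fin.snoc u t : Fin (m + 1) → I) i.castSucc) = _
      simp
    refine ⟨⟨⟨⟨fun z => ⟨⟨fun u => H (z.1, Fin.snoc u z.2), by fun_prop⟩, fun u hu => ?_⟩, ?_⟩,
      fun t => ?_, fun t => ?_⟩, ?_⟩⟩
    · have hu := snoc_mem_boundary hu z.2
      exact (H.eq_fst _ hu).trans ((genLoopOfPath p).2 _ hu)
    · refine continuous_genLoop_mk ?_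
      change Continuous fun z : (I × I) × (Fin m → I) => H (z.1.1, Fin.snoc z.2 z.1.2)
      fun_prop
    · exact GenLoop.ext _ _ fun u => (H.apply_zero _).trans (key p t u)
    · exact GenLoop.ext _ _ fun u => (H.apply_one _).trans (key q t u)
    · intro s t ht
      refine GenLoop.ext _ _ fun u => (H.eq_fst s (x := Fin.snoc u t)
        ⟨Fin.last m, ?_⟩).trans (key p t u)
      simpa using ht

/-- `genLoopMap` as a continuous map. -/
def genLoopMapC (N : Type*) (f : C(X, Y)) (h : f x = y) : C(GenLoop N X x, GenLoop N Y y) where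
  toFun := genLoopMap f h
  continuous_toFun :=
    (f.continuous_postcomp.comp continuous_subtype_val).subtype_mk _

/-- The two ways around a square are homotopic. -/
theorem homotopic_square {a b c d : X} (L : C(I × I, X)) (p : Path a b) (q : Path b d)
    (r : Path a c) (s : Path c d) (hp : ∀ t, L (0, t) = p t) (hq : ∀ t, L (t, 1) = q t)
    (hr : ∀ t, L (t, 0) = r t) (hs : ∀ t, L (1, t) = s t) :
    (p.trans q).Homotopic (r.trans s) := by
  obtain rfl : L (0, 0) = a := by rw [hp, p.source]
  obtain rfl : L (0, 1) = b := by rw [hp, p.target]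
  obtain rfl : L (1, 0) = c := by rw [hr, r.target]
  obtain rfl : L (1, 1) = d := by rw [hs, s.target]
  let p' : Path ((0, 0) : I × I) (0, 1) := ⟨⟨fun t => (0, t), by fun_prop⟩, rfl, rfl⟩
  let q' : Path ((0, 1) : I × I) (1, 1) := ⟨⟨fun t => (t, 1), by fun_prop⟩, rfl, rfl⟩
  let r' : Path ((0, 0) : I × I) (1, 0) := ⟨⟨fun t => (t, 0), by fun_prop⟩, rfl, rfl⟩
  let s' : Path ((1, 0) : I × I) (1, 1) := ⟨⟨fun t => (1, t), by fun_prop⟩, rfl, rfl⟩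
  obtain rfl : p = p'.map L.continuous := by ext t; exact (hp t).symm
  obtain rfl : q = q'.map L.continuous := by ext t; exact (hq t).symm
  obtain rfl : r = r'.map L.continuous := by ext t; exact (hr t).symm
  obtain rfl : s = s'.map L.continuous := by ext t; exact (hs t).symm
  rw [← Path.map_trans, ← Path.map_trans]
  -- The square is simply connected, so its two boundary routes are already homotopic there; `L`
  -- transports the homotopy.
  have : ContractibleSpace I := (convex_Icc (0 : ℝ) 1).contractibleSpace ⟨0, by simp⟩
  exact (SimplyConnectedSpace.paths_homotopic (p'.trans q') (r'.trans s')).map L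

theorem homotopic_of_square {a b : X} (L : C(I × I, X)) (p q : Path a b)
    (h₀ : ∀ t, L (0, t) = a) (h₀' : ∀ t, L (t, 0) = a) (hp : ∀ t, L (t, 1) = p t)
    (hq : ∀ t, L (1, t) = q t) : p.Homotopic q := by
  have h := homotopic_square L (.refl a) p (.refl a) q h₀ hp h₀' hq
  rw [← Path.Homotopic.Quotient.eq] at h ⊢
  simpa using h

end Loops

/-! ### Loops in homotopy fibres -/

section RelLoops

variable {X Y : Type*} [TopologicalSpace X] [TopologicalSpace Y] {N : Type*} {m : ℕ}

/-- The set of generalized loops in the homotopy fibre of `f` over `y`: loops in `X` together with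
a null homotopy of the image under `f`. -/
def relLoops (N : Type*) (f : C(X, Y)) (x : X) (y : Y) :
    Set (C(N → I, X) × C((N → I) × I, Y)) :=
  {a | (∀ u ∈ Cube.boundary N, a.1 u = x) ∧ (∀ u, a.2 (u, 0) = y) ∧
    (∀ u, a.2 (u, 1) = f (a.1 u)) ∧ ∀ u ∈ Cube.boundary N, ∀ t, a.2 (u, t) = y}

/-- The constant loop in the homotopy fibre. -/
def relConst (N : Type*) (x : X) (y : Y) : C(N → I, X) × C((N → I) × I, Y) :=
  (ContinuousMap.const _ x, ContinuousMap.const _ y)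

variable {f : C(X, Y)} {x : X} {y : Y}

/-- The path of loops underlying an element of `relLoops`. -/
def relPath (h : f x = y) (a : C(N → I, X) × C((N → I) × I, Y)) (ha : a ∈ relLoops N f x y) :
    Path (GenLoop.const : GenLoop N Y y) (genLoopMap f h ⟨a.1, ha.1⟩) where
  toFun t := ⟨⟨fun u => a.2 (u, t), by fun_prop⟩, fun u hu => ha.2.2.2 u hu t⟩
  continuous_toFun := by
    refine continuous_genLoop_mk ?_
    change Continuous fun z : I × (N → I) => a.2 (z.2, z.1)
    fun_prop
  source' := GenLoop.ext _ _ ha.2.1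
  target' := GenLoop.ext _ _ ha.2.2.1

/-- `t ↦ min (2 * t) 1` -/
def double₁ : C(I, I) := ⟨fun t => Set.projIcc 0 1 zero_le_one (2 * t), by fun_prop⟩

/-- `t ↦ max (2 * t - 1) 0` -/
def double₂ : C(I, I) := ⟨fun t => Set.projIcc 0 1 zero_le_one (2 * t - 1), by fun_prop⟩

theorem double₁_zero : double₁ 0 = 0 := by simp [double₁]
theorem double₁_one : double₁ 1 = 1 := Set.projIcc_of_right_le zero_le_one (by norm_num)
theorem double₂_one : double₂ 1 = 1 := Set.projIcc_of_right_le zero_le_one (by norm_num)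

/-- The two reparametrizations act one after the other, which lets two deformations be concatenated
by a single formula. -/
theorem double_eq (t : I) : double₂ t = 0 ∨ double₁ t = 1 := by
  rcases le_total (2 * (t : ℝ)) 1 with h | h
  · exact Or.inl (Set.projIcc_of_le_left zero_le_one (by linarith))
  · exact Or.inr (Set.projIcc_of_right_le zero_le_one h)

/-- If a map is injective on `π_m` and surjective on `π_{m+1}`, then `π_m` of its homotopy fibre
vanishes. -/
theorem joinedIn_relLoops (h : f x = y)
    (hinj : Function.Injective (homotopyGroupMap (N := Fin m) f h))
    (hsurj : Function.Surjective (homotopyGroupMap (N := Fin (m + 1)) f h))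
    {a : C((Fin m) → I, X) × C(((Fin m) → I) × I, Y)} (ha : a ∈ relLoops (Fin m) f x y) :
    JoinedIn (relLoops (Fin m) f x y) (relConst (Fin m) x y) a := by
  subst h
  set φ := genLoopMapC (Fin m) f (rfl : f x = f x)
  have key (p q : Path (φ GenLoop.const) (φ GenLoop.const)) :
      p.Homotopic q ↔ GenLoop.Homotopic (genLoopOfPath (x := f x) (m := m) p)
        (genLoopOfPath (x := f x) (m := m) q) :=
    path_homotopic_iff (m := m) (X := Y) (x := f x) (p := p) (q := q)
  let s : GenLoop (Fin m) X x := ⟨a.1, ha.1⟩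
  let γ : Path (φ GenLoop.const) (φ s) := relPath rfl a ha
  -- The path `γ` contracts the image of `s`, so injectivity contracts `s` itself. The image of `h₀`
  -- need not be homotopic to `γ`.
  obtain ⟨h₀⟩ : Joined GenLoop.const s := by
    refine genLoop_homotopic_iff_joined.1 (Quotient.exact (hinj (Quotient.sound ?_)))
    exact genLoop_homotopic_iff_joined.2 ⟨γ⟩
  -- Surjectivity one degree higher provides a correcting loop: the image of `e` followed by `h₀` is
  -- homotopic to `γ`.
  obtain ⟨e, he⟩ : ∃ e : Path (GenLoop.const : GenLoop (Fin m) X x) GenLoop.const,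
      (e.map φ.continuous).Homotopic (γ.trans (h₀.map φ.continuous).symm) := by
    obtain ⟨e, he⟩ := hsurj (Quotient.mk _
      (genLoopOfPath (γ.trans (h₀.map φ.continuous).symm)))
    induction e using Quotient.inductionOn with
    | h e =>
    refine ⟨genLoopToPath e, (key _ _).2 ?_⟩
    have he := Quotient.exact he
    rw [← genLoopOfPath_toPath e] at he
    exact he
  have hK : ((e.trans h₀).map φ.continuous).Homotopic γ := by
    rw [Path.map_trans]
    refine (he.hcomp (.refl (h₀.map φ.continuous))).trans ?_
    rw [← Path.Homotopic.Quotient.eq]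
    rw [Path.Homotopic.Quotient.mk_trans, Path.Homotopic.Quotient.mk_trans,
      Path.Homotopic.Quotient.mk_symm, Path.Homotopic.Quotient.trans_assoc,
      Path.Homotopic.Quotient.symm_trans, Path.Homotopic.Quotient.trans_refl]
  obtain ⟨K⟩ := hK
  set k := e.trans h₀
  have hK₀ (t : I) : K (0, t) = φ (k t) := K.apply_zero t
  -- In the first half the loop runs along `k`, with the initial part of `φ ∘ k` as its null
  -- homotopy. In the second half the loop stays at `s`, and `K` deforms `φ ∘ k` into `γ`.
  refine ⟨⟨⟨fun r => (⟨fun u => k (double₁ r) u, by fun_prop⟩,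
    ⟨fun z => K (double₂ r, double₁ r * z.2) z.1, by fun_prop⟩), ?_⟩, ?_, ?_⟩, ?_⟩
  · refine Continuous.prodMk ?_ ?_
    · refine ContinuousMap.continuous_of_continuous_uncurry _ ?_
      change Continuous fun z : I × (Fin m → I) => k (double₁ z.1) z.2
      fun_prop
    · refine ContinuousMap.continuous_of_continuous_uncurry _ ?_
      change Continuous fun z : I × ((Fin m → I) × I) =>
        K (double₂ z.1, double₁ z.1 * z.2.2) z.2.1
      fun_prop
  · refine Prod.ext (ContinuousMap.ext fun u => ?_) (ContinuousMap.ext fun u => ?_)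
    · change k (double₁ 0) u = x
      rw [double₁_zero, k.source]
      rfl
    · change K (double₂ 0, double₁ 0 * u.2) u.1 = f x
      rw [double₁_zero, zero_mul, K.source]
      rfl
  · refine Prod.ext (ContinuousMap.ext fun u => ?_) (ContinuousMap.ext fun u => ?_)
    · change k (double₁ 1) u = a.1 u
      rw [double₁_one, k.target]
      rfl
    · change K (double₂ 1, double₁ 1 * u.2) u.1 = a.2 u
      rw [double₁_one, double₂_one, one_mul, K.apply_one]
      rfl
  · refine fun r => ⟨fun u hu => (k _).2 u hu, fun u => ?_, fun u => ?_, fun u hu t => ?_⟩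
    · change K (double₂ r, double₁ r * 0) u = _
      rw [mul_zero, K.source]
      rfl
    · change K (double₂ r, double₁ r * 1) u = f (k (double₁ r) u)
      rw [mul_one]
      rcases double_eq r with hr | hr
      · rw [hr, hK₀]
        rfl
      · rw [hr, K.target, k.target]
        rfl
    · exact (K _).2 u hu

/-- If the homotopy groups of the homotopy fibre of a map vanish, then the map is bijective on
homotopy groups of positive degree. -/
theorem bijective_of_joinedIn_relLoops (h : f x = y)
    (H : ∀ m, ∀ a ∈ relLoops (Fin m) f x y,
      JoinedIn (relLoops (Fin m) f x y) (relConst (Fin m) x y) a) (m : ℕ) :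
    Function.Bijective (homotopyGroupMap (N := Fin (m + 1)) f h) := by
  subst h
  set φ := genLoopMapC (Fin m) f (rfl : f x = f x)
  have key (p q : Path (φ GenLoop.const) (φ GenLoop.const)) :
      p.Homotopic q ↔ GenLoop.Homotopic (genLoopOfPath (x := f x) (m := m) p)
        (genLoopOfPath (x := f x) (m := m) q) :=
    path_homotopic_iff (m := m) (X := Y) (x := f x) (p := p) (q := q)
  constructor
  · intro p q
    induction p using Quotient.inductionOn with
    | h p =>
    induction q using Quotient.inductionOn with
    | h q =>
    intro hpq
    have hpq : GenLoop.Homotopic (genLoopMap f rfl p) (genLoopMap f rfl q) := Quotient.exact hpq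
    refine Quotient.sound ?_
    change GenLoop.Homotopic p q
    obtain ⟨p, rfl⟩ : ∃ p', genLoopOfPath p' = p := ⟨_, genLoopOfPath_toPath p⟩
    obtain ⟨q, rfl⟩ : ∃ q', genLoopOfPath q' = q := ⟨_, genLoopOfPath_toPath q⟩
    have hpq : (p.map φ.continuous).Homotopic (q.map φ.continuous) := (key _ _).2 hpq
    rw [← path_homotopic_iff]
    -- A null homotopy of the image of `p · q⁻¹` makes this loop an element of the homotopy fibre;
    -- contracting it there contracts `p · q⁻¹` in the source.
    have hr : ((p.trans q.symm).map φ.continuous).Homotopic (Path.refl (φ GenLoop.const)) := by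
      rw [Path.map_trans, ← Path.map_symm]
      refine (hpq.hcomp (.refl _)).trans ?_
      rw [← Path.Homotopic.Quotient.eq, Path.Homotopic.Quotient.mk_trans,
        Path.Homotopic.Quotient.mk_symm, Path.Homotopic.Quotient.trans_symm,
        Path.Homotopic.Quotient.mk_refl]
    obtain ⟨K⟩ := genLoop_homotopic_iff_joined.1 ((key _ _).1 hr).symm
    have ha : ((genLoopOfPath (p.trans q.symm)).1,
        (⟨fun z => K z.2 z.1, by fun_prop⟩ : C((Fin (m + 1) → I) × I, Y))) ∈
        relLoops (Fin (m + 1)) f x (f x) := by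
      refine ⟨(genLoopOfPath (p.trans q.symm)).2, fun u => ?_, fun u => ?_,
        fun u hu t => (K t).2 u hu⟩
      · change K 0 u = _
        rw [K.source]
        rfl
      · change K 1 u = _
        rw [K.target]
        rfl
    obtain ⟨w, hw⟩ := H _ _ ha
    have hr' : (p.trans q.symm).Homotopic (Path.refl _) := by
      refine path_homotopic_iff.2 (genLoop_homotopic_iff_joined.2
        (Joined.symm ⟨⟨⟨fun t => ⟨(w t).1, (hw t).1⟩, ?_⟩, ?_, ?_⟩⟩))
      · exact Continuous.subtype_mk (by fun_prop) _
      · refine Subtype.ext ?_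
        change (w 0).1 = _
        rw [w.source]
        rfl
      · refine Subtype.ext ?_
        change (w 1).1 = _
        rw [w.target]
    rw [← Path.Homotopic.Quotient.eq] at hr' ⊢
    have := congrArg (fun z => Path.Homotopic.Quotient.trans z (.mk q)) hr'
    simpa [Path.Homotopic.Quotient.trans_assoc] using this
  · intro b
    induction b using Quotient.inductionOn with
    | h b =>
    obtain ⟨b, rfl⟩ : ∃ b', genLoopOfPath b' = b := ⟨_, genLoopOfPath_toPath b⟩
    -- The connecting map: `b` over the constant loop is an `m`-loop in the homotopy fibre.
    -- Contracting it traces out an `(m + 1)`-loop `s` in the source.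
    have ha : ((ContinuousMap.const _ x : C((Fin m) → I, X)),
        (⟨fun z => b z.2 z.1, by fun_prop⟩ : C((Fin m → I) × I, Y))) ∈
        relLoops (Fin m) f x (f x) := by
      refine ⟨fun _ _ => rfl, fun u => ?_, fun u => ?_, fun u hu t => (b t).2 u hu⟩
      · change b 0 u = _
        rw [b.source]
        rfl
      · change b 1 u = _
        rw [b.target]
        rfl
    obtain ⟨w, hw⟩ := H _ _ ha
    let s : Path (GenLoop.const : GenLoop (Fin m) X x) GenLoop.const :=
      { toFun := fun t => ⟨(w t).1, (hw t).1⟩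
        continuous_toFun := Continuous.subtype_mk (by fun_prop) _
        source' := by
          refine Subtype.ext ?_
          change (w 0).1 = _
          rw [w.source]
          rfl
        target' := by
          refine Subtype.ext ?_
          change (w 1).1 = _
          rw [w.target]
          rfl }
    refine ⟨Quotient.mk _ (genLoopOfPath s), Quotient.sound ?_⟩
    refine (key (s.map φ.continuous) b).1 ?_
    -- The null homotopies carried along by `w` fill a square with two constant sides, the other
    -- sides being the image of `s` and `b`.
    refine homotopic_of_square (X := GenLoop (Fin m) Y (f x))
      ⟨fun z => relPath rfl (w z.1) (hw z.1) z.2, continuous_genLoop_mk (by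
        change Continuous fun z : (I × I) × (Fin m → I) => (w z.1.1).2 (z.2, z.1.2)
        fun_prop)⟩ (s.map φ.continuous) b ?_ ?_ ?_ ?_
    · refine fun t => GenLoop.ext _ _ fun u => ?_
      change (w 0).2 (u, t) = _
      rw [w.source]
      rfl
    · exact fun t => (relPath rfl (w t) (hw t)).source
    · exact fun t => (relPath rfl (w t) (hw t)).target
    · refine fun t => GenLoop.ext _ _ fun u => ?_
      change (w 1).2 (u, t) = _
      rw [w.target]
      rfl

end RelLoops

/-! ### Equivariant sections over Γ-CW complexes -/

section

open Metric Set

namespace GammaCWComplex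

variable {Γ : Type w} [Group Γ] {E : Type v} [TopologicalSpace E] [MulAction Γ E]
  (C : GammaCWComplex Γ E)

/-- The union of the closed cells of dimension less than `n`. -/
def skeletonLT (n : ℕ) : Set E :=
  {z | ∃ m < n, ∃ (i : C.cell m) (x : _) (γ : Γ), γ • C.map m i x = z}

theorem smul_mem_skeletonLT {n : ℕ} {z : E} (γ : Γ) (hz : z ∈ C.skeletonLT n) :
    γ • z ∈ C.skeletonLT n := by
  obtain ⟨m, hm, i, x, γ', rfl⟩ := hz
  exact ⟨m, hm, i, x, γ * γ', mul_smul _ _ _⟩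

theorem smul_mem_skeletonLT_iff {n : ℕ} {z : E} (γ : Γ) :
    γ • z ∈ C.skeletonLT n ↔ z ∈ C.skeletonLT n := by
  refine ⟨fun h => ?_, C.smul_mem_skeletonLT γ⟩
  simpa using C.smul_mem_skeletonLT γ⁻¹ h

theorem skeletonLT_mono {m n : ℕ} (h : m ≤ n) : C.skeletonLT m ⊆ C.skeletonLT n :=
  fun _ ⟨k, hk, hz⟩ => ⟨k, hk.trans_le h, hz⟩

theorem map_mem_skeletonLT {n : ℕ} (i : C.cell n) {x : closedBall (0 : Fin n → ℝ) 1}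
    (hx : x.1 ∈ sphere 0 1) : C.map n i x ∈ C.skeletonLT n := by
  obtain ⟨J, hJ⟩ := C.boundary n i
  obtain ⟨m, hm, j, -, y, h⟩ := hJ x hx
  exact ⟨m, hm, j.2, y, j.1, h.symm⟩

theorem mem_ball_or_sphere {n : ℕ} (x : closedBall (0 : Fin n → ℝ) 1) :
    x.1 ∈ ball 0 1 ∨ x.1 ∈ sphere 0 1 :=
  lt_or_eq_of_le (mem_closedBall.1 x.2)

/-- A point on the boundary of a cell lies in closed cells of lower dimension, so descent on the
dimension ends in an open cell. -/
theorem exists_open_cell {n : ℕ} {z : E} (hz : z ∈ C.skeletonLT n) :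
    ∃ m < n, ∃ (i : C.cell m) (x : _) (γ : Γ), x.1 ∈ ball 0 1 ∧ γ • C.map m i x = z := by
  induction n using Nat.strong_induction_on with
  | h n ih =>
  obtain ⟨m, hm, i, x, γ, rfl⟩ := hz
  rcases mem_ball_or_sphere x with hx | hx
  · exact ⟨m, hm, i, x, γ, hx, rfl⟩
  · obtain ⟨k, hk, h⟩ := ih m hm (C.smul_mem_skeletonLT γ (C.map_mem_skeletonLT i hx))
    exact ⟨k, hk.trans hm, h⟩

theorem map_notMem_skeletonLT {n : ℕ} (i : C.cell n) {x : closedBall (0 : Fin n → ℝ) 1}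
    (hx : x.1 ∈ ball 0 1) : C.map n i x ∉ C.skeletonLT n := by
  intro h
  obtain ⟨m, hm, j, y, γ, hy, h⟩ := C.exists_open_cell h
  exact hm.ne (congrArg Sigma.fst (C.disjoint ⟨m, j⟩ ⟨n, i⟩ γ y x hy hx h))

theorem exists_mem_skeletonLT (z : E) : ∃ n, z ∈ C.skeletonLT n := by
  obtain ⟨n, i, x, γ, h⟩ := C.cover z
  exact ⟨n + 1, n, n.lt_succ_self, i, x, γ, h⟩

/-- Turns hypotheses on isotropy groups of points into hypotheses on the groups `stab` of cells. -/
theorem stabilizer_map {n : ℕ} (i : C.cell n) {x : closedBall (0 : Fin n → ℝ) 1}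
    (hx : x.1 ∈ ball 0 1) : MulAction.stabilizer Γ (C.map n i x) = C.stab n i := by
  ext γ
  exact ⟨fun h => (C.injective n i γ x x hx hx h).1, fun h => C.smul_map n i γ h x⟩

/-- A map out of a `Γ`-CW complex is continuous if it is so on every closed cell. -/
theorem continuous_of_cells {Z : Type*} [TopologicalSpace Z] {g : E → Z}
    (hg : ∀ n i (γ : Γ), Continuous fun x => g (γ • C.map n i x)) : Continuous g :=
  continuous_iff_isClosed.2 fun _ hA => C.isClosed _ fun n i γ => hA.preimage (hg n i γ)

variable {W : Type*} [TopologicalSpace W] [MulAction Γ W]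

/-- An equivariant map that is continuous on all closed cells of dimension less than `n` is
continuous on the boundaries of the `n`-cells. -/
theorem continuousOn_sphere (hW : ∀ γ : Γ, Continuous fun x : W => γ • x) {g : E → W} {n : ℕ}
    (hequiv : ∀ z ∈ C.skeletonLT n, ∀ γ : Γ, g (γ • z) = γ • g z)
    (hcont : ∀ m < n, ∀ i, Continuous fun x => g (C.map m i x)) (i : C.cell n) :
    ContinuousOn (fun x => g (C.map n i x)) {x | x.1 ∈ sphere 0 1} := by
  have := C.t2
  obtain ⟨J, hJ⟩ := C.boundary n i
  let K := Σ m : Fin n, J m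
  let c (k : K) (y : closedBall (0 : Fin k.1 → ℝ) 1) : E := k.2.1.1 • C.map k.1 k.2.1.2 y
  have hc (k : K) : Continuous (c k) := (C.continuous_smul _).comp (C.map _ _).continuous
  have hcompact (m : ℕ) : CompactSpace (closedBall (0 : Fin m → ℝ) 1) :=
    isCompact_iff_compactSpace.1 (isCompact_closedBall 0 1)
  have hgc (k : K) : Continuous fun y => g (c k y) := by
    have : (fun y => g (c k y)) = fun y => k.2.1.1 • g (C.map k.1 k.2.1.2 y) := by
      funext y
      exact hequiv _ ⟨k.1, k.1.2, k.2.1.2, y, 1, one_smul _ _⟩ _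
    rw [this]
    exact (hW _).comp (hcont _ k.1.2 _)
  -- A closed cell is the image of a compact ball in a Hausdorff space, so continuity on it can be
  -- tested on the ball; finitely many such closed images cover the boundary.
  have hclosed (k : K) : IsClosedMap (c k) := by
    have := hcompact k.1
    exact (hc k).isClosedMap
  have hrange (k : K) : ContinuousOn g (range (c k)) := by
    refine continuousOn_iff_isClosed.2 fun t ht =>
      ⟨c k '' ((fun y => g (c k y)) ⁻¹' t), hclosed k _ (ht.preimage (hgc k)), ?_⟩
    ext z
    constructor
    · rintro ⟨hz, y, rfl⟩
      exact ⟨⟨y, hz, rfl⟩, y, rfl⟩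
    · rintro ⟨⟨y, hy, rfl⟩, -⟩
      exact ⟨hy, y, rfl⟩
  refine ContinuousOn.mono (s := ⋃ k : K, C.map n i ⁻¹' range (c k)) ?_ ?_
  · refine (locallyFinite_of_finite _).continuousOn_iUnion (fun k => ?_) fun k => ?_
    · exact (hclosed k).isClosed_range.preimage (C.map n i).continuous
    · exact (hrange k).comp (C.map n i).continuous.continuousOn fun _ h => h
  · intro x hx
    obtain ⟨m, hm, j, hj, y, h⟩ := hJ x hx
    exact mem_iUnion.2 ⟨⟨⟨m, hm⟩, ⟨j, hj⟩⟩, y, h.symm⟩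

variable (q : E → Set W)

/-- An equivariant section of `q` over the union of the cells of dimension less than `n`. -/
structure IsSection (n : ℕ) (g : E → W) : Prop where
  mem : ∀ z ∈ C.skeletonLT n, g z ∈ q z
  map_smul : ∀ z ∈ C.skeletonLT n, ∀ γ : Γ, g (γ • z) = γ • g z
  continuous_map : ∀ m < n, ∀ i, Continuous fun x => g (C.map m i x)

variable {q}

open Classical in
-- An extension `G i` over one representative of each orbit of cells spreads by `γ • G i x`. This is
-- well defined because the values of `G i` are fixed by the cell's stabilizer.
theorem IsSection.exists_extension (hW : ∀ γ : Γ, Continuous fun x : W => γ • x)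
    (hq : ∀ (γ : Γ) z, ∀ w ∈ q z, γ • w ∈ q (γ • z)) {n : ℕ}
    (hext : ∀ (i : C.cell n) (s : closedBall (0 : Fin n → ℝ) 1 → W),
      ContinuousOn s {x | x.1 ∈ sphere 0 1} →
      (∀ x, x.1 ∈ sphere 0 1 → s x ∈ q (C.map n i x) ∧ ∀ γ ∈ C.stab n i, γ • s x = s x) →
      ∃ g : C(closedBall (0 : Fin n → ℝ) 1, W), (∀ x, x.1 ∈ sphere 0 1 → g x = s x) ∧
        ∀ x, g x ∈ q (C.map n i x) ∧ ∀ γ ∈ C.stab n i, γ • g x = g x)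
    {g : E → W} (hg : C.IsSection q n g) :
    ∃ g', C.IsSection q (n + 1) g' ∧ EqOn g g' (C.skeletonLT n) := by
  choose G hGs hGq hGfix using fun i =>
    hext i (fun x => g (C.map n i x)) (C.continuousOn_sphere hW hg.map_smul hg.continuous_map i)
      fun x hx => ⟨hg.mem _ (C.map_mem_skeletonLT i hx), fun γ hγ => by
        rw [← hg.map_smul _ (C.map_mem_skeletonLT i hx), C.smul_map n i γ hγ]⟩
  let P (z : E) (p : C.cell n × closedBall (0 : Fin n → ℝ) 1 × Γ) : Prop :=
    p.2.1.1 ∈ ball 0 1 ∧ p.2.2 • C.map n p.1 p.2.1 = z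
  let g' (z : E) : W :=
    if z ∈ C.skeletonLT n then g z else
      if h : ∃ p, P z p then h.choose.2.2 • G h.choose.1 h.choose.2.1 else g z
  have hg' : EqOn g g' (C.skeletonLT n) := fun z hz => (if_pos hz).symm
  -- Independence of the chosen representative: on the open cell two choices differ by an element of
  -- the stabilizer, and on the boundary the old section is recovered.
  have key (i : C.cell n) (x) (γ : Γ) : g' (γ • C.map n i x) = γ • G i x := by
    rcases mem_ball_or_sphere x with hx | hx
    · have h : ∃ p, P (γ • C.map n i x) p := ⟨⟨i, x, γ⟩, hx, rfl⟩
      have : g' (γ • C.map n i x) = h.choose.2.2 • G h.choose.1 h.choose.2.1 := by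
        refine (if_neg ?_).trans (dif_pos h)
        rw [smul_mem_skeletonLT_iff]
        exact C.map_notMem_skeletonLT i hx
      rw [this]
      obtain ⟨hx', hp⟩ := h.choose_spec
      generalize h.choose = p at hx' hp
      obtain ⟨j, y, δ⟩ := p
      dsimp only at hx' hp ⊢
      have hp : (γ⁻¹ * δ) • C.map n j y = C.map n i x := by
        rw [mul_smul, hp, inv_smul_smul]
      obtain rfl : j = i := eq_of_heq (Sigma.mk.inj
        (C.disjoint ⟨n, j⟩ ⟨n, i⟩ _ y x hx' hx hp)).2
      obtain ⟨hδ, rfl⟩ := C.injective n j _ y x hx' hx hp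
      conv_rhs => rw [← hGfix j y _ hδ, smul_smul, mul_inv_cancel_left]
    · have := C.map_mem_skeletonLT i hx
      rw [← hg' (C.smul_mem_skeletonLT γ this), hg.map_smul _ this, hGs i x hx]
  refine ⟨g', ⟨fun z hz => ?_, fun z hz δ => ?_, fun m hm i => ?_⟩, hg'⟩
  · obtain ⟨m, hm, i, x, γ, rfl⟩ := hz
    rcases Nat.lt_succ_iff_lt_or_eq.1 hm with hm | rfl
    · have hz : γ • C.map m i x ∈ C.skeletonLT n := ⟨m, hm, i, x, γ, rfl⟩
      rw [← hg' hz]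
      exact hg.mem _ hz
    · rw [key]
      exact hq _ _ _ (hGq i x)
  · obtain ⟨m, hm, i, x, γ, rfl⟩ := hz
    rcases Nat.lt_succ_iff_lt_or_eq.1 hm with hm | rfl
    · have hz : γ • C.map m i x ∈ C.skeletonLT n := ⟨m, hm, i, x, γ, rfl⟩
      rw [← hg' hz, ← hg' (C.smul_mem_skeletonLT δ hz), hg.map_smul _ hz]
    · rw [smul_smul, key, key, mul_smul]
  · rcases Nat.lt_succ_iff_lt_or_eq.1 hm with hm | rfl
    · have : (fun x => g' (C.map m i x)) = fun x => g (C.map m i x) :=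
        funext fun x => (hg' ⟨m, hm, i, x, 1, one_smul _ _⟩).symm
      rw [this]
      exact hg.continuous_map m hm i
    · have : (fun x => g' (C.map m i x)) = G i :=
        funext fun x => by simpa using key i x 1
      rw [this]
      exact (G i).continuous

/-- Equivariant sections over a `Γ`-CW complex can be constructed cell by cell. -/
theorem exists_section [Nonempty W] (hW : ∀ γ : Γ, Continuous fun x : W => γ • x)
    (hq : ∀ (γ : Γ) z, ∀ w ∈ q z, γ • w ∈ q (γ • z))
    (hext : ∀ n (i : C.cell n) (s : closedBall (0 : Fin n → ℝ) 1 → W),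
      ContinuousOn s {x | x.1 ∈ sphere 0 1} →
      (∀ x, x.1 ∈ sphere 0 1 → s x ∈ q (C.map n i x) ∧ ∀ γ ∈ C.stab n i, γ • s x = s x) →
      ∃ g : C(closedBall (0 : Fin n → ℝ) 1, W), (∀ x, x.1 ∈ sphere 0 1 → g x = s x) ∧
        ∀ x, g x ∈ q (C.map n i x) ∧ ∀ γ ∈ C.stab n i, γ • g x = g x) :
    ∃ g : C(E, W), (∀ z, g z ∈ q z) ∧ ∀ (γ : Γ) z, g (γ • z) = γ • g z := by
  choose next hnext heq using fun n (g : {g : E → W // C.IsSection q n g}) =>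
    g.2.exists_extension C hW hq (hext n)
  -- There are no cells of dimension less than 0, so any function starts the induction.
  have hzero : C.IsSection q 0 fun _ => Classical.arbitrary W := by
    refine ⟨fun z hz => ?_, fun z hz => ?_, fun m hm => absurd hm m.not_lt_zero⟩ <;>
    · obtain ⟨m, hm, -⟩ := hz
      exact absurd hm m.not_lt_zero
  let gs (n : ℕ) : {g : E → W // C.IsSection q n g} :=
    Nat.rec ⟨_, hzero⟩ (fun n g => ⟨next n g, hnext n g⟩) n
  have hgs {n k : ℕ} (h : n ≤ k) : EqOn (gs n).1 (gs k).1 (C.skeletonLT n) := by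
    induction k, h using Nat.le_induction with
    | base => exact fun _ _ => rfl
    | succ k hk ih => exact ih.trans ((heq k (gs k)).mono (C.skeletonLT_mono hk))
  choose N hN using C.exists_mem_skeletonLT
  let g (z : E) : W := (gs (N z)).1 z
  have hg (n : ℕ) {z : E} (hz : z ∈ C.skeletonLT n) : g z = (gs n).1 z :=
    (hgs (le_max_left _ n) (hN z)).trans (hgs (le_max_right _ n) hz).symm
  have hsmul (γ : Γ) (z : E) : g (γ • z) = γ • g z := by
    rw [hg _ (C.smul_mem_skeletonLT γ (hN z)), (gs (N z)).2.map_smul _ (hN z)]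
  refine ⟨⟨g, C.continuous_of_cells fun n i γ => ?_⟩, fun z => (gs (N z)).2.mem _ (hN z), hsmul⟩
  have : (fun x => g (γ • C.map n i x)) = fun x => γ • (gs (n + 1)).1 (C.map n i x) :=
    funext fun x => by
      rw [hsmul, hg (n + 1) ⟨n, n.lt_succ_self, i, x, 1, one_smul _ _⟩]
  rw [this]
  exact (hW γ).comp ((gs (n + 1)).2.continuous_map n n.lt_succ_self i)

end GammaCWComplex

end

/-! ### Extending null homotopies over balls and over Γ-CW complexes -/

section

open Metric Set

section Null

variable {Q : Type*} [TopologicalSpace Q] {n : ℕ}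

/-- All generalized loops at `r` in the set `A` are null homotopic in `A`. -/
def IsLoopNull (A : Set Q) (r : Q) : Prop :=
  ∀ (n : ℕ) (c : C(Fin n → I, Q)), (∀ u ∈ Cube.boundary (Fin n), c u = r) → (∀ u, c u ∈ A) →
    ∃ K : C(I × (Fin n → I), Q), (∀ u, K (0, u) = c u) ∧ (∀ u, K (1, u) = r) ∧
      (∀ t, ∀ u ∈ Cube.boundary (Fin n), K (t, u) = r) ∧ ∀ z, K z ∈ A

/-- The radial retraction onto the closed unit ball. -/
def clampBall (n : ℕ) : C(Fin n → ℝ, closedBall (0 : Fin n → ℝ) 1) where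
  toFun x := ⟨(max 1 ‖x‖)⁻¹ • x, by
    have : 0 < max 1 ‖x‖ := by positivity
    rw [mem_closedBall_zero_iff, norm_smul, norm_inv, Real.norm_of_nonneg this.le,
      inv_mul_le_one₀ this]
    exact le_max_right _ _⟩
  continuous_toFun := by
    have h (x : Fin n → ℝ) : max 1 ‖x‖ ≠ 0 := by positivity
    exact (((continuous_const.max continuous_norm).inv₀ h).smul continuous_id).subtype_mk _

theorem clampBall_of_le {x : Fin n → ℝ} (h : ‖x‖ ≤ 1) : (clampBall n x).1 = x := by
  change (max 1 ‖x‖)⁻¹ • x = x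
  rw [max_eq_left h, inv_one, one_smul]

theorem clampBall_mem_sphere {x : Fin n → ℝ} (h : 1 ≤ ‖x‖) :
    (clampBall n x).1 ∈ sphere (0 : Fin n → ℝ) 1 := by
  have : ‖x‖ ≠ 0 := by positivity
  change (max 1 ‖x‖)⁻¹ • x ∈ _
  rw [max_eq_right h, mem_sphere_zero_iff_norm, norm_smul, norm_inv, norm_norm,
    inv_mul_cancel₀ this]

/-- The homeomorphism from the cube to the closed unit ball for the maximum norm. -/
def cubeToBall (n : ℕ) : C(Fin n → I, closedBall (0 : Fin n → ℝ) 1) where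
  toFun u := ⟨fun i => 2 * u i - 1, by
    rw [mem_closedBall_zero_iff, pi_norm_le_iff_of_nonneg zero_le_one]
    intro i
    rw [Real.norm_eq_abs, abs_le]
    have := (u i).2.1
    have := (u i).2.2
    constructor <;> linarith⟩
  continuous_toFun := by fun_prop

theorem cubeToBall_mem_sphere {u : Fin n → I} (hu : u ∈ Cube.boundary (Fin n)) :
    (cubeToBall n u).1 ∈ sphere (0 : Fin n → ℝ) 1 := by
  obtain ⟨i, hi⟩ := hu
  refine le_antisymm (cubeToBall n u).2 ?_
  rw [dist_zero_right]
  refine le_trans ?_ (norm_le_pi_norm (cubeToBall n u).1 i)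
  change 1 ≤ ‖2 * (u i : ℝ) - 1‖
  rcases hi with hi | hi <;> rw [hi] <;> norm_num

/-- The homeomorphism from the closed unit ball for the maximum norm to the cube. -/
def ballToCube (n : ℕ) : C(closedBall (0 : Fin n → ℝ) 1, Fin n → I) where
  toFun x i := projIcc 0 1 zero_le_one ((x.1 i + 1) / 2)
  continuous_toFun := continuous_pi fun i => continuous_projIcc.comp
    ((((continuous_apply i).comp continuous_subtype_val).add continuous_const).div_const 2)

theorem coe_ballToCube (x : closedBall (0 : Fin n → ℝ) 1) (i : Fin n) :
    (ballToCube n x i : ℝ) = (x.1 i + 1) / 2 := by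
  have h := (norm_le_pi_norm x.1 i).trans (mem_closedBall_zero_iff.1 x.2)
  rw [Real.norm_eq_abs, abs_le] at h
  change (projIcc 0 1 zero_le_one ((x.1 i + 1) / 2) : ℝ) = _
  rw [projIcc_of_mem zero_le_one ⟨by linarith, by linarith⟩]

theorem cubeToBall_ballToCube (x : closedBall (0 : Fin n → ℝ) 1) :
    cubeToBall n (ballToCube n x) = x := by
  refine Subtype.ext (funext fun i => ?_)
  change 2 * (ballToCube n x i : ℝ) - 1 = _
  rw [coe_ballToCube]
  ring

theorem ballToCube_mem_boundary {x : closedBall (0 : Fin n → ℝ) 1} (hx : x.1 ∈ sphere 0 1) :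
    ballToCube n x ∈ Cube.boundary (Fin n) := by
  rw [mem_sphere_zero_iff_norm] at hx
  obtain ⟨i, hi⟩ : ∃ i, ‖x.1 i‖ = 1 := by
    by_contra! h
    refine (((pi_norm_lt_iff zero_lt_one).2 fun i => lt_of_le_of_ne ?_ (h i)).ne hx)
    exact (norm_le_pi_norm x.1 i).trans hx.le
  refine ⟨i, ?_⟩
  rcases eq_or_eq_neg_of_abs_eq hi with hi | hi
  · right
    refine Subtype.ext ?_
    rw [coe_ballToCube, hi]
    norm_num
  · left
    refine Subtype.ext ?_
    rw [coe_ballToCube, hi]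
    norm_num

theorem IsLoopNull.exists_ball {A : Set Q} {r : Q} (hA : IsLoopNull A r)
    (c : C(closedBall (0 : Fin n → ℝ) 1, Q)) (hc : ∀ x, x.1 ∈ sphere 0 1 → c x = r)
    (hcA : ∀ x, c x ∈ A) :
    ∃ K : C(closedBall (0 : Fin n → ℝ) 1 × I, Q), (∀ x, K (x, 0) = c x) ∧ (∀ x, K (x, 1) = r) ∧
      (∀ x t, x.1 ∈ sphere 0 1 → K (x, t) = r) ∧ ∀ z, K z ∈ A := by
  obtain ⟨K, h₀, h₁, hK, hKA⟩ := hA n (c.comp (cubeToBall n))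
    (fun u hu => hc _ (cubeToBall_mem_sphere hu)) fun u => hcA _
  refine ⟨⟨fun z => K (z.2, ballToCube n z.1), by fun_prop⟩, fun x => ?_, fun x => h₁ _,
    fun x t hx => hK t _ (ballToCube_mem_boundary hx), fun z => hKA _⟩
  refine (h₀ _).trans ?_
  rw [ContinuousMap.comp_apply, cubeToBall_ballToCube]

/-- If all loops in `A` are null homotopic, then a null homotopy over the boundary of a ball of a
map to `A` that is defined on the whole ball extends to the ball. -/
theorem IsLoopNull.exists_extension {A : Set Q} {r : Q} (hA : IsLoopNull A r)
    (b : C(closedBall (0 : Fin n → ℝ) 1, Q)) (hb : ∀ x, b x ∈ A)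
    (s : closedBall (0 : Fin n → ℝ) 1 → C(I, Q)) (hs : ContinuousOn s {x | x.1 ∈ sphere 0 1})
    (hsA : ∀ x, x.1 ∈ sphere 0 1 → ∀ t, s x t ∈ A)
    (hs₀ : ∀ x, x.1 ∈ sphere 0 1 → s x 0 = r) (hs₁ : ∀ x, x.1 ∈ sphere 0 1 → s x 1 = b x) :
    ∃ T : C(closedBall (0 : Fin n → ℝ) 1 × I, Q), (∀ x, T (x, 0) = r) ∧ (∀ x, T (x, 1) = b x) ∧
      (∀ x t, x.1 ∈ sphere 0 1 → T (x, t) = s x t) ∧ ∀ z, T z ∈ A := by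
  let e (x : closedBall (0 : Fin n → ℝ) 1) : closedBall (0 : Fin n → ℝ) 1 :=
    clampBall n ((2 : ℝ) • x.1)
  have he : Continuous e := by fun_prop
  let τ (x : closedBall (0 : Fin n → ℝ) 1) : I := projIcc 0 1 zero_le_one (2 - 2 * ‖x.1‖)
  have hτ : Continuous τ := by fun_prop
  have he_sphere {x : closedBall (0 : Fin n → ℝ) 1} (hx : 1 / 2 ≤ ‖x.1‖) :
      (e x).1 ∈ sphere (0 : Fin n → ℝ) 1 := by
    refine clampBall_mem_sphere ?_
    rw [norm_smul, Real.norm_of_nonneg zero_le_two]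
    linarith
  -- A rescaled copy of `b` on the ball of radius 1/2, with `s` run backwards from time 1 to 0
  -- across the outer shell. The result is constantly `r` on the sphere, so it can be contracted.
  let c (x : closedBall (0 : Fin n → ℝ) 1) : Q := if ‖x.1‖ ≤ 1 / 2 then b (e x) else s (e x) (τ x)
  have hc₁ {x : closedBall (0 : Fin n → ℝ) 1} (hx : ‖x.1‖ ≤ 1 / 2) : c x = b (e x) := if_pos hx
  have hc₂ {x : closedBall (0 : Fin n → ℝ) 1} (hx : 1 / 2 ≤ ‖x.1‖) : c x = s (e x) (τ x) := by
    rcases hx.lt_or_eq with h | h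
    · exact if_neg h.not_ge
    · have : τ x = 1 := by
        change projIcc _ _ _ _ = _
        rw [← h]
        exact projIcc_of_right_le _ (by norm_num)
      rw [hc₁ h.ge, this, hs₁ _ (he_sphere hx)]
  have hc : Continuous c := by
    rw [← continuousOn_univ]
    have h₁ : ContinuousOn c {x | ‖x.1‖ ≤ 1 / 2} :=
      (b.continuous.comp he).continuousOn.congr fun x hx => hc₁ hx
    have h₂ : ContinuousOn c {x | 1 / 2 ≤ ‖x.1‖} :=
      ((hs.comp he.continuousOn fun x hx => he_sphere hx).eval hτ.continuousOn).congr
        fun x hx => hc₂ hx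
    refine (h₁.union_of_isClosed h₂ (isClosed_le (by fun_prop) (by fun_prop))
      (isClosed_le (by fun_prop) (by fun_prop))).mono fun x _ => le_total ‖x.1‖ (1 / 2)
  obtain ⟨K, hK₀, hK₁, hK, hKA⟩ := hA.exists_ball ⟨c, hc⟩ (fun x hx => by
    have hx' := mem_sphere_zero_iff_norm.1 hx
    change c x = r
    have : τ x = 0 := by
      change projIcc _ _ _ _ = _
      rw [hx']
      exact projIcc_of_le_left _ (by norm_num)
    rw [hc₂ (by rw [hx']; norm_num), this]
    exact hs₀ _ (he_sphere (by rw [hx']; norm_num))) (fun x => by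
    rcases le_total ‖x.1‖ (1 / 2) with hx | hx
    · exact (hc₁ hx).symm.subst (motive := (· ∈ A)) (hb _)
    · exact (hc₂ hx).symm.subst (motive := (· ∈ A)) (hsA _ (he_sphere hx) _))
  have hnorm (x : closedBall (0 : Fin n → ℝ) 1) : ‖x.1‖ ≤ 1 := mem_closedBall_zero_iff.1 x.2
  -- With `ρ = ‖x‖`, the homotopy time `2(1 - t)(1 - ρ)` vanishes at `t = 1` and at `ρ = 1`. There
  -- the scaling factor is `1/2`, respectively `1 - t/2`, so `c` returns `b x`, respectively `s x
  -- t`. At `t = 0`, either `ρ ≤ 1/2` and the time is at least 1, or `ρ ≥ 1/2` and the radius `ρ(3 -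
  -- 2ρ)` is at least 1; both give `r`.
  refine ⟨⟨fun z => K (clampBall n
    (((2 - z.2) / 2 + 2 * (1 - z.2) * (1 - ‖z.1.1‖) : ℝ) • z.1.1),
    projIcc 0 1 zero_le_one (2 * (1 - z.2) * (1 - ‖z.1.1‖))), by fun_prop⟩,
    fun x => ?_, fun x => ?_, fun x t hx => ?_, fun z => hKA _⟩
  · change K (clampBall n (((2 - ((0 : I) : ℝ)) / 2 + 2 * (1 - ((0 : I) : ℝ)) * (1 - ‖x.1‖) : ℝ)
      • x.1), projIcc 0 1 zero_le_one (2 * (1 - ((0 : I) : ℝ)) * (1 - ‖x.1‖))) = r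
    have hx := hnorm x
    rw [show ((0 : I) : ℝ) = 0 from rfl]
    rcases le_total ‖x.1‖ (1 / 2) with h | h
    · rw [projIcc_of_right_le _ (by linarith)]
      exact hK₁ _
    · refine hK _ _ (clampBall_mem_sphere ?_)
      rw [norm_smul, Real.norm_of_nonneg (by linarith)]
      nlinarith
  · change K (clampBall n (((2 - ((1 : I) : ℝ)) / 2 + 2 * (1 - ((1 : I) : ℝ)) * (1 - ‖x.1‖) : ℝ)
      • x.1), projIcc 0 1 zero_le_one (2 * (1 - ((1 : I) : ℝ)) * (1 - ‖x.1‖))) = b x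
    have hx := hnorm x
    rw [show ((1 : I) : ℝ) = 1 from rfl, projIcc_of_le_left _ (by simp)]
    have hx' : ‖((2 - 1) / 2 + 2 * (1 - 1) * (1 - ‖x.1‖) : ℝ) • x.1‖ ≤ 1 / 2 := by
      rw [norm_smul, Real.norm_of_nonneg (by norm_num)]
      linarith
    refine (hK₀ _).trans ((hc₁ ?_).trans (congrArg b (Subtype.ext ?_)))
    · rwa [clampBall_of_le (hx'.trans (by norm_num))]
    · change (clampBall n _).1 = _
      rw [clampBall_of_le (x := _ • x.1) (hx'.trans (by norm_num)), smul_smul]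
      norm_num
      exact clampBall_of_le hx
  · change K (clampBall n (((2 - (t : ℝ)) / 2 + 2 * (1 - (t : ℝ)) * (1 - ‖x.1‖) : ℝ)
      • x.1), projIcc 0 1 zero_le_one (2 * (1 - (t : ℝ)) * (1 - ‖x.1‖))) = s x t
    have hx' := mem_sphere_zero_iff_norm.1 hx
    have ht₀ := t.2.1
    have ht₁ := t.2.2
    rw [hx', sub_self, mul_zero, add_zero, projIcc_of_le_left _ le_rfl]
    have h : ‖((2 - (t : ℝ)) / 2) • x.1‖ = (2 - (t : ℝ)) / 2 := by
      rw [norm_smul, Real.norm_of_nonneg (by linarith), hx', mul_one]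
    have h' := clampBall_of_le (h.trans_le (by linarith))
    refine (hK₀ _).trans ((hc₂ ?_).trans ?_)
    · rw [h', h]
      linarith
    · have h₁ : e (clampBall n (((2 - (t : ℝ)) / 2) • x.1)) = x := by
        refine Subtype.ext ?_
        change (max 1 ‖(2 : ℝ) • (clampBall n (((2 - (t : ℝ)) / 2) • x.1)).1‖)⁻¹ •
          ((2 : ℝ) • (clampBall n (((2 - (t : ℝ)) / 2) • x.1)).1) = x.1
        rw [h', norm_smul, h, Real.norm_of_nonneg zero_le_two, max_eq_right (by linarith),
          smul_smul, smul_smul]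
        have : (2 * ((2 - (t : ℝ)) / 2))⁻¹ * 2 * ((2 - (t : ℝ)) / 2) = 1 := by
          have : 2 - (t : ℝ) ≠ 0 := by linarith
          field_simp
        rw [this, one_smul]
      have h₂ : τ (clampBall n (((2 - (t : ℝ)) / 2) • x.1)) = t := by
        change projIcc _ _ _ _ = _
        rw [h', h]
        refine (congrArg _ ?_).trans (projIcc_val zero_le_one t)
        ring
      rw [h₁, h₂]

end Null

/-- Let `A` be an invariant subset of a `Γ`-space such that for all isotropy groups `H` of a
`Γ`-CW complex `E` all loops in the set of `H`-fixed points of `A` are null homotopic. Then every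
equivariant map from `E` to `A` is equivariantly null homotopic. -/
theorem GammaCWComplex.exists_nullHomotopy {Γ : Type w} [Group Γ] {E : Type v}
    [TopologicalSpace E] [MulAction Γ E] (C : GammaCWComplex Γ E) {Q : Type*} [TopologicalSpace Q]
    [MulAction Γ Q] [ContinuousConstSMul Γ Q] {A : Set Q} (hA : ∀ (γ : Γ), ∀ a ∈ A, γ • a ∈ A)
    {r : Q} (hr : ∀ γ : Γ, γ • r = r)
    (hnull : ∀ z : E, IsLoopNull (A ∩ {a | ∀ γ ∈ MulAction.stabilizer Γ z, γ • a = a}) r)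
    (f : C(E, Q)) (hfA : ∀ z, f z ∈ A) (hf : ∀ (γ : Γ) z, f (γ • z) = γ • f z) :
    ∃ g : C(E, C(I, Q)), (∀ z, g z 0 = r ∧ g z 1 = f z ∧ ∀ t, g z t ∈ A) ∧
      ∀ (γ : Γ) z, g (γ • z) = γ • g z := by
  have : Nonempty C(I, Q) := ⟨ContinuousMap.const _ r⟩
  -- A null homotopy is a section whose value at `z` is a path in `A` from `r` to `f z`.
  refine C.exists_section (q := fun z => {g : C(I, Q) | g 0 = r ∧ g 1 = f z ∧ ∀ t, g t ∈ A})
    continuous_const_smul ?_ ?_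
  · rintro γ z g ⟨h₀, h₁, h⟩
    refine ⟨?_, ?_, fun t => hA γ _ (h t)⟩
    · rw [ContinuousMap.smul_apply, h₀, hr]
    · rw [ContinuousMap.smul_apply, h₁, hf]
  · intro n i s hs hsq
    -- The stabilizer of the cell is the isotropy group of its centre, so the hypothesis at that
    -- point governs the whole cell.
    have h₀ := C.stabilizer_map i (x := ⟨0, by simp⟩) (by simp)
    have hN := hnull (C.map n i ⟨0, by simp⟩)
    rw [h₀] at hN
    obtain ⟨T, hT₀, hT₁, hT, hTA⟩ := hN.exists_extension (f.comp (C.map n i))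
      (fun x => ⟨hfA _, fun γ hγ => by
        rw [ContinuousMap.comp_apply, ← hf, C.smul_map n i γ hγ]⟩) s hs
      (fun x hx t => ⟨(hsq x hx).1.2.2 t, fun γ hγ =>
        congrArg (fun g : C(I, Q) => g t) ((hsq x hx).2 γ hγ)⟩)
      (fun x hx => (hsq x hx).1.1) fun x hx => (hsq x hx).1.2.1
    refine ⟨T.curry, fun x hx => ContinuousMap.ext fun t => hT x t hx, fun x =>
      ⟨⟨hT₀ x, hT₁ x, fun t => (hTA _).1⟩, fun γ hγ => ContinuousMap.ext fun t =>
        (hTA (x, t)).2 γ hγ⟩⟩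

end

/-! ### Loops of fixed points of `relLoops` -/

section Fixed

variable {Γ : Type w} [Group Γ] {X Y : Type*} [TopologicalSpace X] [TopologicalSpace Y]
  [MulAction Γ X] [MulAction Γ Y] [ContinuousConstSMul Γ X] [ContinuousConstSMul Γ Y]

theorem continuous_fin_append {j m : ℕ} :
    Continuous fun p : (Fin j → I) × (Fin m → I) => Fin.append p.1 p.2 := by
  refine continuous_pi fun i => ?_
  induction i using Fin.addCases with
  | left i => simp only [Fin.append_left]; fun_prop
  | right i => simp only [Fin.append_right]; fun_prop

theorem append_mem_boundary {j m : ℕ} {u : Fin j → I} {v : Fin m → I}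
    (h : u ∈ Cube.boundary (Fin j) ∨ v ∈ Cube.boundary (Fin m)) :
    Fin.append u v ∈ Cube.boundary (Fin (j + m)) := by
  rcases h with ⟨i, hi⟩ | ⟨i, hi⟩
  · exact ⟨i.castAdd m, by simpa using hi⟩
  · exact ⟨i.natAdd j, by simpa using hi⟩

/-- If the homotopy groups of the homotopy fibre of the map of `H`-fixed sets vanish, then loops of
`H`-fixed generalized loops in the homotopy fibre are null homotopic. -/
theorem isLoopNull_relLoops {f : C(X, Y)} {H : Subgroup Γ}
    {f' : C(MulAction.fixedPoints H X, MulAction.fixedPoints H Y)} (hf' : ∀ x, (f' x).1 = f x.1)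
    {x : MulAction.fixedPoints H X} {y : MulAction.fixedPoints H Y}
    (h : ∀ k, ∀ a ∈ relLoops (Fin k) f' x y,
      JoinedIn (relLoops (Fin k) f' x y) (relConst (Fin k) x y) a) (m : ℕ) :
    IsLoopNull (relLoops (Fin m) f x.1 y.1 ∩ {a | ∀ γ ∈ H, γ • a = a})
      (relConst (Fin m) x.1 y.1) := by
  intro j c hc hcA
  let l (u : Fin (j + m) → I) : Fin j → I := fun i => u (i.castAdd m)
  let r (u : Fin (j + m) → I) : Fin m → I := fun i => u (i.natAdd j)
  have hl : Continuous l := by fun_prop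
  have hr : Continuous r := by fun_prop
  have hlr {u} (hu : u ∈ Cube.boundary (Fin (j + m))) :
      l u ∈ Cube.boundary (Fin j) ∨ r u ∈ Cube.boundary (Fin m) := by
    obtain ⟨i, hi⟩ := hu
    induction i using Fin.addCases with
    | left i => exact Or.inl ⟨i, hi⟩
    | right i => exact Or.inr ⟨i, hi⟩
  -- A `j`-loop of `m`-loops is a `(j + m)`-loop, and being `H`-fixed means taking values in the
  -- `H`-fixed sets.
  let a : C(Fin (j + m) → I, MulAction.fixedPoints H X) ×
      C((Fin (j + m) → I) × I, MulAction.fixedPoints H Y) :=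
    (⟨fun u => ⟨(c (l u)).1 (r u), fun γ =>
        congrArg (fun b : C(Fin m → I, X) × C((Fin m → I) × I, Y) => b.1 (r u))
          ((hcA (l u)).2 γ γ.2)⟩, by fun_prop⟩,
      ⟨fun z => ⟨(c (l z.1)).2 (r z.1, z.2), fun γ =>
        congrArg (fun b : C(Fin m → I, X) × C((Fin m → I) × I, Y) => b.2 (r z.1, z.2))
          ((hcA (l z.1)).2 γ γ.2)⟩, by fun_prop⟩)
  have ha : a ∈ relLoops (Fin (j + m)) f' x y := by
    refine ⟨fun u hu => Subtype.ext ?_, fun u => Subtype.ext ?_, fun u => Subtype.ext ?_,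
      fun u hu t => Subtype.ext ?_⟩
    · change (c (l u)).1 (r u) = x.1
      rcases hlr hu with hu | hu
      · rw [hc _ hu]
        rfl
      · exact (hcA (l u)).1.1 _ hu
    · exact (hcA (l u)).1.2.1 _
    · exact ((hcA (l u)).1.2.2.1 _).trans (hf' (a.1 u)).symm
    · change (c (l u)).2 (r u, t) = y.1
      rcases hlr hu with hu | hu
      · rw [hc _ hu]
        rfl
      · exact (hcA (l u)).1.2.2.2 _ hu t
  obtain ⟨w, hw⟩ := h _ a ha
  have happ := continuous_fin_append (j := j) (m := m)
  -- Time is reversed because `w` starts at the constant loop, whereas the null homotopy must end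
  -- there.
  refine ⟨⟨fun z => (⟨fun v => ((w (unitInterval.symm z.1)).1 (Fin.append z.2 v)).1, ?_⟩,
    ⟨fun v => ((w (unitInterval.symm z.1)).2 (Fin.append z.2 v.1, v.2)).1, ?_⟩), ?_⟩,
    fun u => ?_, fun u => ?_, fun t u hu => ?_, fun z => ⟨⟨fun v hv => ?_, fun v => ?_,
      fun v => ?_, fun v hv t => ?_⟩, fun γ hγ => ?_⟩⟩
  · have : Continuous fun v : Fin m → I => Fin.append z.2 v := happ.comp (f := fun v => (z.2, v)) (by fun_prop)
    fun_prop
  · have : Continuous fun v : (Fin m → I) × I => Fin.append z.2 v.1 :=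
      happ.comp (f := fun v : (Fin m → I) × I => (z.2, v.1)) (by fun_prop)
    fun_prop
  · refine Continuous.prodMk ?_ ?_
    · refine ContinuousMap.continuous_of_continuous_uncurry _ ?_
      change Continuous fun z : (I × (Fin j → I)) × (Fin m → I) =>
        ((w (unitInterval.symm z.1.1)).1 (Fin.append z.1.2 z.2)).1
      have : Continuous fun z : (I × (Fin j → I)) × (Fin m → I) => Fin.append z.1.2 z.2 :=
        happ.comp (f := fun z : (I × (Fin j → I)) × (Fin m → I) => (z.1.2, z.2)) (by fun_prop)
      fun_prop
    · refine ContinuousMap.continuous_of_continuous_uncurry _ ?_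
      change Continuous fun z : (I × (Fin j → I)) × ((Fin m → I) × I) =>
        ((w (unitInterval.symm z.1.1)).2 (Fin.append z.1.2 z.2.1, z.2.2)).1
      have : Continuous fun z : (I × (Fin j → I)) × ((Fin m → I) × I) =>
          Fin.append z.1.2 z.2.1 :=
        happ.comp (f := fun z : (I × (Fin j → I)) × ((Fin m → I) × I) => (z.1.2, z.2.1))
          (by fun_prop)
      fun_prop
  · have hl' (v : Fin m → I) : l (Fin.append u v) = u := funext fun i => by simp [l]
    have hr' (v : Fin m → I) : r (Fin.append u v) = v := funext fun i => by simp [r]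
    refine Prod.ext (ContinuousMap.ext fun v => ?_) (ContinuousMap.ext fun v => ?_)
    · change ((w (unitInterval.symm 0)).1 (Fin.append u v)).1 = (c u).1 v
      rw [unitInterval.symm_zero, w.target]
      change (c (l _)).1 (r _) = _
      rw [hl', hr']
    · change ((w (unitInterval.symm 0)).2 (Fin.append u v.1, v.2)).1 = (c u).2 v
      rw [unitInterval.symm_zero, w.target]
      change (c (l (Fin.append u v.1))).2 (r (Fin.append u v.1), v.2) = _
      rw [hl', hr']
  · refine Prod.ext (ContinuousMap.ext fun v => ?_) (ContinuousMap.ext fun v => ?_)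
    · change ((w (unitInterval.symm 1)).1 (Fin.append u v)).1 = x.1
      rw [unitInterval.symm_one, w.source]
      rfl
    · change ((w (unitInterval.symm 1)).2 (Fin.append u v.1, v.2)).1 = y.1
      rw [unitInterval.symm_one, w.source]
      rfl
  · exact Prod.ext
      (ContinuousMap.ext fun v => congrArg Subtype.val ((hw _).1 _ (append_mem_boundary (Or.inl hu))))
      (ContinuousMap.ext fun v => congrArg Subtype.val ((hw _).2.2.2 _ (append_mem_boundary (Or.inl hu)) _))
  · exact congrArg Subtype.val ((hw _).1 _ (append_mem_boundary (Or.inr hv)))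
  · exact congrArg Subtype.val ((hw _).2.1 _)
  · exact (congrArg Subtype.val ((hw _).2.2.1 _)).trans (hf' _)
  · exact congrArg Subtype.val ((hw _).2.2.2 _ (append_mem_boundary (Or.inr hv)) _)
  · exact Prod.ext (ContinuousMap.ext fun v => (Subtype.prop _ : _ ∈ MulAction.fixedPoints H X)
      ⟨γ, hγ⟩) (ContinuousMap.ext fun v => (Subtype.prop _ : _ ∈ MulAction.fixedPoints H Y)
      ⟨γ, hγ⟩)

end Fixed

/-! ### Homotopy fibres of equivariant mapping spaces -/

section Map

variable {Γ : Type w} [Group Γ] {E : Type v} [TopologicalSpace E] [MulAction Γ E]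
  {X Y : Type*} [TopologicalSpace X] [TopologicalSpace Y]

/-- A family of maps out of a `Γ`-CW complex can be regarded as a map to a mapping space. -/
theorem GammaCWComplex.continuous_flip (C : GammaCWComplex Γ E) {K : Type*} [TopologicalSpace K]
    (φ : K → C(E, X)) (hφ : Continuous φ) (hφ' : ∀ e, Continuous fun k => φ k e) :
    Continuous fun e => (⟨fun k => φ k e, hφ' e⟩ : C(K, X)) := by
  -- `E` need not be locally compact, so evaluation on `C(E, X)` may fail to be continuous. After
  -- restriction to a compact cell it is continuous, and the weak topology reduces the claim to
  -- cells.
  refine C.continuous_of_cells fun n i γ => ContinuousMap.continuous_of_continuous_uncurry _ ?_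
  let c : C(Metric.closedBall (0 : Fin n → ℝ) 1, E) :=
    ⟨fun x => γ • C.map n i x, (C.continuous_smul γ).comp (C.map n i).continuous⟩
  have : CompactSpace (Metric.closedBall (0 : Fin n → ℝ) 1) :=
    isCompact_iff_compactSpace.1 (isCompact_closedBall 0 1)
  have h : Continuous fun k => (φ k).comp c := c.continuous_precomp.comp hφ
  exact (h.comp continuous_snd).eval continuous_fst

variable [MulAction Γ X] [MulAction Γ Y] [ContinuousConstSMul Γ X] [ContinuousConstSMul Γ Y]

/-- Exchanging variables, a loop in the homotopy fibre of the mapping spaces is an equivariant map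
`F` from `E` to the loops in the homotopy fibre of `f`. An equivariant null homotopy of `F`,
exchanged back, is the required path. -/
theorem GammaCWComplex.joinedIn_relLoops (C : GammaCWComplex Γ E) {f : C(X, Y)}
    (hf : ∀ (γ : Γ) x, f (γ • x) = γ • f x) {x : X} {y : Y} (hx : ∀ γ : Γ, γ • x = x)
    (hy : ∀ γ : Γ, γ • y = y)
    (hnull : ∀ (z : E) (m : ℕ), IsLoopNull
      (relLoops (Fin m) f x y ∩ {a | ∀ γ ∈ MulAction.stabilizer Γ z, γ • a = a})
      (relConst (Fin m) x y))
    {g : C({φ : C(E, X) // ∀ (γ : Γ) e, φ (γ • e) = γ • φ e},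
      {φ : C(E, Y) // ∀ (γ : Γ) e, φ (γ • e) = γ • φ e})}
    (hg : ∀ φ e, (g φ).1 e = f (φ.1 e)) (x' y') (hx' : ∀ e, x'.1 e = x) (hy' : ∀ e, y'.1 e = y)
    (m : ℕ) (a) (ha : a ∈ relLoops (Fin m) g x' y') :
    JoinedIn (relLoops (Fin m) g x' y') (relConst (Fin m) x' y') a := by
  have h₁ (e : E) : Continuous fun u => (a.1 u).1 e := by fun_prop
  have h₂ (e : E) : Continuous fun u => (a.2 u).1 e := by fun_prop
  let F : C(E, C(Fin m → I, X) × C((Fin m → I) × I, Y)) :=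
    ⟨fun e => (⟨fun u => (a.1 u).1 e, h₁ e⟩, ⟨fun u => (a.2 u).1 e, h₂ e⟩),
      (C.continuous_flip (fun u => (a.1 u).1) (by fun_prop) h₁).prodMk
      (C.continuous_flip (fun u => (a.2 u).1) (by fun_prop) h₂)⟩
  have hA (γ : Γ) (b) (hb : b ∈ relLoops (Fin m) f x y) : γ • b ∈ relLoops (Fin m) f x y := by
    obtain ⟨h₁, h₂, h₃, h₄⟩ := hb
    refine ⟨fun u hu => ?_, fun u => ?_, fun u => ?_, fun u hu t => ?_⟩
    · exact (congrArg (γ • ·) (h₁ u hu)).trans (hx γ)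
    · exact (congrArg (γ • ·) (h₂ u)).trans (hy γ)
    · exact (congrArg (γ • ·) (h₃ u)).trans (hf γ _).symm
    · exact (congrArg (γ • ·) (h₄ u hu t)).trans (hy γ)
  have hr (γ : Γ) : γ • relConst (Fin m) x y = relConst (Fin m) x y :=
    Prod.ext (ContinuousMap.ext fun _ => hx γ) (ContinuousMap.ext fun _ => hy γ)
  have hFA (e : E) : F e ∈ relLoops (Fin m) f x y := by
    refine ⟨fun u hu => ?_, fun u => ?_, fun u => ?_, fun u hu t => ?_⟩
    · exact (congrArg (fun b => b.1 e) (ha.1 u hu)).trans (hx' e)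
    · exact (congrArg (fun b => b.1 e) (ha.2.1 u)).trans (hy' e)
    · exact (congrArg (fun b => b.1 e) (ha.2.2.1 u)).trans (hg _ e)
    · exact (congrArg (fun b => b.1 e) (ha.2.2.2 u hu t)).trans (hy' e)
  have hF (γ : Γ) (e : E) : F (γ • e) = γ • F e :=
    Prod.ext (ContinuousMap.ext fun u => (a.1 u).2 γ e)
      (ContinuousMap.ext fun u => (a.2 u).2 γ e)
  obtain ⟨w, hw, hwΓ⟩ := C.exists_nullHomotopy hA hr (hnull · m) F hFA hF
  have hw₁ (t u) (γ : Γ) (e : E) : (w (γ • e) t).1 u = γ • (w e t).1 u := by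
    rw [hwΓ]
    rfl
  have hw₂ (t u) (γ : Γ) (e : E) : (w (γ • e) t).2 u = γ • (w e t).2 u := by
    rw [hwΓ]
    rfl
  let p (t : I) : C(Fin m → I, {φ : C(E, X) // ∀ (γ : Γ) e, φ (γ • e) = γ • φ e}) :=
    ⟨fun u => ⟨⟨fun e => (w e t).1 u, by fun_prop⟩, hw₁ t u⟩, by
      refine Continuous.subtype_mk (ContinuousMap.continuous_of_continuous_uncurry _ ?_) _
      change Continuous fun z : (Fin m → I) × E => (w z.2 t).1 z.1
      fun_prop⟩
  let q (t : I) : C((Fin m → I) × I, {φ : C(E, Y) // ∀ (γ : Γ) e, φ (γ • e) = γ • φ e}) :=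
    ⟨fun u => ⟨⟨fun e => (w e t).2 u, by fun_prop⟩, hw₂ t u⟩, by
      refine Continuous.subtype_mk (ContinuousMap.continuous_of_continuous_uncurry _ ?_) _
      change Continuous fun z : ((Fin m → I) × I) × E => (w z.2 t).2 z.1
      fun_prop⟩
  have hp : Continuous p := by
    refine ContinuousMap.continuous_of_continuous_uncurry _ (Continuous.subtype_mk
      (ContinuousMap.continuous_of_continuous_uncurry _ ?_) _)
    change Continuous fun z : (I × (Fin m → I)) × E => (w z.2 z.1.1).1 z.1.2
    fun_prop
  have hq : Continuous q := by
    refine ContinuousMap.continuous_of_continuous_uncurry _ (Continuous.subtype_mk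
      (ContinuousMap.continuous_of_continuous_uncurry _ ?_) _)
    change Continuous fun z : (I × ((Fin m → I) × I)) × E => (w z.2 z.1.1).2 z.1.2
    fun_prop
  refine ⟨⟨⟨fun t => (p t, q t), hp.prodMk hq⟩, ?_, ?_⟩,
    fun t => ⟨fun u hu => ?_, fun u => ?_, fun u => ?_, fun u hu s => ?_⟩⟩
  · refine Prod.ext (ContinuousMap.ext fun u => Subtype.ext (ContinuousMap.ext fun e => ?_))
      (ContinuousMap.ext fun u => Subtype.ext (ContinuousMap.ext fun e => ?_))
    · exact (congrArg (fun b => b.1 u) (hw e).1).trans (hx' e).symm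
    · exact (congrArg (fun b => b.2 u) (hw e).1).trans (hy' e).symm
  · refine Prod.ext (ContinuousMap.ext fun u => Subtype.ext (ContinuousMap.ext fun e => ?_))
      (ContinuousMap.ext fun u => Subtype.ext (ContinuousMap.ext fun e => ?_))
    · exact congrArg (fun b => b.1 u) (hw e).2.1
    · exact congrArg (fun b => b.2 u) (hw e).2.1
  · exact Subtype.ext (ContinuousMap.ext fun e => (((hw e).2.2 t).1 u hu).trans (hx' e).symm)
  · exact Subtype.ext (ContinuousMap.ext fun e => (((hw e).2.2 t).2.1 u).trans (hy' e).symm)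
  · exact Subtype.ext (ContinuousMap.ext fun e =>
      (((hw e).2.2 t).2.2.1 u).trans (hg (p t u) e).symm)
  · exact Subtype.ext (ContinuousMap.ext fun e =>
      (((hw e).2.2 t).2.2.2 u hu s).trans (hy' e).symm)

end Map

instance GSpectrum.continuousConstSMul {Γ : Type w} [Group Γ] (S : GSpectrum.{u} Γ) (n : ℕ) :
    ContinuousConstSMul Γ (S.space n) :=
  ⟨S.continuous_smul n⟩

end EquivSpectra

end

/-! ### The theorem on homotopy fixed spectra -/

theorem mainTheorem7 {Γ : Type*} [Group Γ] (𝓕 : Set (Subgroup Γ))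
    (h𝓕 : EquivSpectra.IsFamily 𝓕)
    (E : Type*) [TopologicalSpace E] [MulAction Γ E]
    (hE : EquivSpectra.IsUniversalSpace 𝓕 E)
    (S T : EquivSpectra.GSpectrum Γ)
    (hS : ∀ G ∈ 𝓕, (S.fixed G).IsOmega) (hT : ∀ G ∈ 𝓕, (T.fixed G).IsOmega)
    (F : S.Hom T)
    (hF : ∀ G ∈ 𝓕, (F.fixed G).IsWeakEquiv) :
    (F.homotopyFixed E hE).IsWeakEquiv := by
  obtain ⟨C⟩ := hE.cw
  refine EquivSpectra.Spectrum.Hom.isWeakEquiv_of_bijective fun m n =>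
    EquivSpectra.bijective_of_joinedIn_relLoops _ (fun k a ha => ?_) m
  refine C.joinedIn_relLoops (F.map_smul n) (S.smul_pt n) (T.smul_pt n) (fun z l => ?_)
    (fun _ _ => rfl) _ _ (fun _ => rfl) (fun _ => rfl) k a ha
  have hz := hE.isotropy z
  have hbij := (hF _ hz).termMap_bijective (hS _ hz) (hT _ hz)
  -- Vanishing of `π_j` of the fibre takes injectivity in degree `j` and surjectivity in degree `j +
  -- 1`, both on fixed sets of the isotropy group of `z`.
  exact EquivSpectra.isLoopNull_relLoops (fun _ => rfl)
    (fun j a ha => EquivSpectra.joinedIn_relLoops _ (hbij j n).1 (hbij (j + 1) n).2 ha) l
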